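/- An \emph{abelian processor} with input alphabet $I$, state space $Q$ and output alphabets $(A_u)_{u\in U}$ consists of pairwise commuting maps $t_a:Q\to Q$ ($a\in I$) and message functions $o_a^u:Q\to A_u^*$ such that input words that agree up to permutation, read from the same state, produce outputs that agree up to permutation for each $u$. An \emph{abelian network} $\mathcal N$ on a directed graph $G=(V,E)$ (loops allowed) assigns to each $v\in V$ an abelian processor with input alphabet $A_v$, state space $Q_v$ and output alphabets $(A_u)_{(v,u)\in E}$. Put $A=\bigsqcup_v A_v$ and $Q=\prod_v Q_v$. Processing a letter $a\in A_v$ in the configuration $\mathbf x.\mathbf q\in\mathbb Z^A\times Q$ removes one $a$ from $\mathbf x$, adds the letters of the words $o_a^u(\mathbf q_v)$, and replaces $\mathbf q_v$ by $t_a(\mathbf q_v)$. A word $w\in A^*$ is a \emph{legal} execution for $\mathbf x.\mathbf q$ if each of its letters is present (with count at least $1$) when it is processed, and \emph{complete} if the final letter vector is $\le \mathbf 0$. $\mathcal N$ is \emph{finite} if $V$ and all $A_v$, $Q_v$ are finite, and \emph{halts on all inputs} if each $\mathbf x.\mathbf q$ with $\mathbf x\in\mathbb N^A$, $\mathbf q\in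 Q$ has a complete legal execution; the final state $\mathbf x\rhd\!\rhd\mathbf q$ does not depend on which one is chosen. For a commutative monoid $M$ of self-maps of a set $X$, the action is \emph{irreducible} if $X\ne\emptyset$ and for all $x,x'\in X$ there are $m,m'\in M$ with $mx=m'x'$; if $M$ is finite, its \emph{minimal idempotent} is the unique idempotent $e\in M$ with $e\in Mm$ for all $m\in M$. Let $M_v=\langle t_a\rangle_{a\in A_v}$ with minimal idempotent $e_v$; $\mathcal N$ is \emph{irreducible} if each $M_v$ acts irreducibly on $Q_v$. A state $\mathbf q$ is \emph{locally recurrent} if $\mathbf q_v\in e_vQ_v$ for all $v$, and \emph{recurrent} if $\mathbf q\in eQ$, where $e$ is the minimal idempotent of the monoid generated by the maps $\mathbf q\mapsto 1_a\rhd\!\rhd\mathbf q$, $a\in A$. Each $t_a$, $a\in A_v$, permutes $e_vQ_v$; let $K_v$ be the kernel of the resulting action of $\mathbb Z^{A_v}$ on $e_vQ_v$, let $K=\prod_v K_v\subseteq\mathbb Z^A$ and $r_a=\min\{m\ge1: m1_a\in K\}$. For $\mathbf k\in K\cap\mathbb N^A$ and a locally recurrent $\mathbf q$, let $P_{\mathbf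 q}(\mathbf k)\in\mathbb N^A$ count the letters sent when a word with $\mathbf k_a$ letters $a$ for each $a\in A$ is processed starting from $\mathbf q$ (which returns the network to $\mathbf q$). For irreducible $\mathcal N$ this does not depend on $\mathbf q$; write $P=P_{\mathbf q}$. The \emph{production matrix} $P\in\mathbb Q^{A\times A}$ has entries $P_{ba}=\frac1{r_a}P(r_a1_a)_b$. Let $D=\mathrm{diag}(r_a)$ and $L=(I-P)D$. The \emph{production graph} $\Gamma$ has vertex set $A$ and an edge from $a$ to $b$ whenever $P_{ba}>0$. The \emph{sandpilization} $\mathcal S(\mathcal N)$ is the network on $\Gamma$ in which $a\in A$ has a one-letter alphabet $\{a\}$ and state space $\mathbb Z/r_a\mathbb Z$, each letter increases the state by $1$, and on passing from $r_a-1$ to $0$ the processor at $a$ sends $r_aP_{ba}$ letters $b$ to each $b$. \textbf{Theorem.} Let $\mathcal N$ be a finite irreducible abelian network that halts on all inputs. The following are equivalent. (1) Every locally recurrent state of $\mathcal N$ is recurrent. (2) $\det L=\det D$. (3) Every state of $\mathcal S(\mathcal N)$ is recurrent. (4) The state $\mathbf 0$ of $\mathcal S(\mathcal N)$ is recurrent.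 (5) The production graph $\Gamma$ has no directed cycle (a loop counts as a cycle). (6) The production matrix $P$ is nilpotent. -/

import Mathlib

/-! ### Actions of a monoid of self-maps -/

/-- `e` is the minimal idempotent of the (commutative) monoid `M` of self-maps of `X`: the
idempotent of `M` that is accessible from all of `M`, i.e. `e ∈ M m` for every `m ∈ M`. -/
def IsMinimalIdempotent {X : Type*} (M : Submonoid (Function.End X)) (e : Function.End X) : Prop :=
  e ∈ M ∧ e * e = e ∧ ∀ m ∈ M, ∃ m' ∈ M, m' * m = e

/-- The set `e X` of recurrent elements, where `e` is the minimal idempotent of `M`. -/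
def recurrentSet {X : Type*} (M : Submonoid (Function.End X)) : Set X :=
  {x | ∃ e : Function.End X, IsMinimalIdempotent M e ∧ ∃ y : X, e y = x}

/-- The action of `M` on `X` is irreducible: the relation `∃ m m' ∈ M, m x = m' x'` has exactly
one equivalence class. -/
def IsIrreducibleAction {X : Type*} (M : Submonoid (Function.End X)) : Prop :=
  Nonempty X ∧ ∀ x x' : X, ∃ m ∈ M, ∃ m' ∈ M, m x = m' x'

/-! ### Processors -/

/-- An automaton with output: input alphabet `I`, states `Q`, output alphabets `B u`, `u : U`. -/
structure Processor (I Q : Type*) {U : Type*} (B : U → Type*) where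
  /-- state transition maps -/
  t : I → Q → Q
  /-- message passing functions -/
  o : I → (u : U) → Q → List (B u)

namespace Processor

variable {I Q U : Type*} {B : U → Type*}

/-- The state reached from `q` after reading the word `w`. -/
def run (p : Processor I Q B) : List I → Q → Q
  | [], q => q
  | a :: w, q => run p w (p.t a q)

/-- The word sent to the feed `u` when the word `w` is read starting from `q`. -/
def output (p : Processor I Q B) (u : U) : List I → Q → List (B u)
  | [], _ => []
  | a :: w, q => p.o a u q ++ output p u w (p.t a q)

/-- The transition monoid `⟨t_a⟩ ⊆ End Q`. -/
def transitionMonoid (p : Processor I Q B) : Submonoid (Function.End Q) :=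
  Submonoid.closure {f | ∃ a : I, f = p.t a}

end Processor

/-- An abelian processor with output. -/
structure AbelianProcessor (I Q : Type*) {U : Type*} (B : U → Type*) extends
    Processor I Q B where
  t_comm : ∀ (a b : I) (q : Q), t a (t b q) = t b (t a q)
  output_perm : ∀ (w w' : List I), w.Perm w' → ∀ (q : Q) (u : U),
    (toProcessor.output u w q).Perm (toProcessor.output u w' q)

namespace AbelianProcessor

variable {I Q U : Type*} {B : U → Type*}

theorem run_append (p : AbelianProcessor I Q B) (w w' : List I) (q : Q) :
    p.run (w ++ w') q = p.run w' (p.run w q) := by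
  induction w generalizing q with
  | nil => rfl
  | cons a w ih => exact ih _

theorem comm_t (p : AbelianProcessor I Q B) {m : Function.End Q} (hm : m ∈ p.transitionMonoid)
    (a : I) (q : Q) : p.t a (m q) = m (p.t a q) := by
  induction hm using Submonoid.closure_induction generalizing q with
  | mem f hf => obtain ⟨b, rfl⟩ := hf; exact p.t_comm a b q
  | one => rfl
  | mul f g _ _ hf hg =>
    change p.t a (f (g q)) = f (g (p.t a q))
    rw [hf, hg]

theorem comm_run (p : AbelianProcessor I Q B) {m : Function.End Q} (hm : m ∈ p.transitionMonoid)
    (w : List I) (q : Q) : p.run w (m q) = m (p.run w q) := by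
  induction w generalizing q with
  | nil => rfl
  | cons a w ih =>
    change p.run w (p.t a (m q)) = m (p.run w (p.t a q))
    rw [p.comm_t hm, ih]

theorem run_mem_recurrentSet (p : AbelianProcessor I Q B) (w : List I) {q : Q}
    (hq : q ∈ recurrentSet p.transitionMonoid) :
    p.run w q ∈ recurrentSet p.transitionMonoid := by
  obtain ⟨e, he, y, rfl⟩ := hq
  exact ⟨e, he, p.run w y, (p.comm_run he.1 w y).symm⟩

/-- The kernel `K_v ⊆ ℤ^I` of the action of `ℤ^I` on the recurrent set `e Q`. Every letter acts
on `e Q` as a permutation, and `|w| - |w'|` acts as `t_w t_{w'}⁻¹`; so a vector acts trivially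
exactly when it is `|w| - |w'|` for words `w`, `w'` with the same action on `e Q`. -/
def kernel [DecidableEq I] (p : AbelianProcessor I Q B) : AddSubgroup (I → ℤ) where
  carrier := {x | ∃ w w' : List I, (∀ a, x a = (w.count a : ℤ) - (w'.count a : ℤ)) ∧
    ∀ q ∈ recurrentSet p.transitionMonoid, p.run w q = p.run w' q}
  zero_mem' := ⟨[], [], by simp, fun _ _ => rfl⟩
  add_mem' := by
    rintro x y ⟨w, w', hx, hw⟩ ⟨z, z', hy, hz⟩
    refine ⟨w ++ z, w' ++ z', fun a => ?_, fun q hq => ?_⟩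
    · simp only [Pi.add_apply, hx, hy, List.count_append]
      push_cast
      ring
    · rw [run_append, run_append, hw q hq]
      exact hz _ (p.run_mem_recurrentSet w' hq)
  neg_mem' := by
    rintro x ⟨w, w', hx, hw⟩
    exact ⟨w', w, fun a => by simp [hx], fun q hq => (hw q hq).symm⟩

end AbelianProcessor

/-! ### Networks -/

/-- An abelian network with vertices `V`, alphabets `A v` and state spaces `Q v`. The total
alphabet is `Σ v, A v`, and a state of the network is an element of `∀ v, Q v`. -/
structure AbelianNetwork (V : Type*) (A Q : V → Type*) where
  /-- the underlying directed graph (loops are allowed) -/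
  graph : Digraph V
  proc : ∀ v, AbelianProcessor (A v) (Q v) A
  /-- messages are only sent along edges -/
  message_nil : ∀ v u, ¬ graph.Adj v u → ∀ (a : A v) (q : Q v), (proc v).o a u q = []

namespace AbelianNetwork

variable {V : Type*} {A Q : V → Type*} [DecidableEq V] [∀ v, DecidableEq (A v)]

/-- Process the letter `a` in the configuration `x.q`, where `x` counts the waiting letters. -/
def step (N : AbelianNetwork V A Q) (a : Σ v, A v) (s : ((Σ v, A v) → ℤ) × (∀ v, Q v)) :
    ((Σ v, A v) → ℤ) × (∀ v, Q v) :=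
  (fun b => s.1 b - (if b = a then 1 else 0)
      + ((((N.proc a.1).o a.2 b.1 (s.2 a.1)).count b.2 : ℕ) : ℤ),
    Function.update s.2 a.1 ((N.proc a.1).t a.2 (s.2 a.1)))

/-- The result `π_w(x.q)` of executing the word `w`. -/
def exec (N : AbelianNetwork V A Q) :
    List (Σ v, A v) → ((Σ v, A v) → ℤ) × (∀ v, Q v) → ((Σ v, A v) → ℤ) × (∀ v, Q v)
  | [], s => s
  | a :: w, s => exec N w (N.step a s)

/-- The word is legal: each letter is present when it is processed. -/
def IsLegal (N : AbelianNetwork V A Q) :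
    List (Σ v, A v) → ((Σ v, A v) → ℤ) × (∀ v, Q v) → Prop
  | [], _ => True
  | a :: w, s => 1 ≤ s.1 a ∧ IsLegal N w (N.step a s)

/-- The word is complete: no letters remain after its execution. -/
def IsComplete (N : AbelianNetwork V A Q) (w : List (Σ v, A v))
    (s : ((Σ v, A v) → ℤ) × (∀ v, Q v)) : Prop :=
  (N.exec w s).1 ≤ 0

/-- `x.q` has a complete legal execution. -/
def HaltsOn (N : AbelianNetwork V A Q) (x : (Σ v, A v) → ℕ) (q : ∀ v, Q v) : Prop :=
  ∃ w : List (Σ v, A v), N.IsLegal w (fun a => (x a : ℤ), q) ∧ N.IsComplete w (fun a => (x a : ℤ), q)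

/-- The network halts on all inputs. -/
def HaltsOnAllInputs (N : AbelianNetwork V A Q) : Prop :=
  ∀ (x : (Σ v, A v) → ℕ) (q : ∀ v, Q v), N.HaltsOn x q

open Classical in
/-- The global action `x ▷▷ q`: the final state of a complete legal execution of `x.q` (the same
for all of them). The value is only meaningful when the network halts on `x.q`. -/
noncomputable def globalAct (N : AbelianNetwork V A Q) (x : (Σ v, A v) → ℕ) (q : ∀ v, Q v) :
    ∀ v, Q v :=
  if h : N.HaltsOn x q then (N.exec h.choose (fun a => (x a : ℤ), q)).2 else q

/-- The global monoid, generated by the maps `τ_a : q ↦ 1_a ▷▷ q`. -/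
noncomputable def globalMonoid (N : AbelianNetwork V A Q) : Submonoid (Function.End (∀ v, Q v)) :=
  Submonoid.closure {f | ∃ a : Σ v, A v, f = fun q => N.globalAct (Pi.single a 1) q}

/-- `q = e q` for the minimal idempotent `e` of the global monoid. -/
def IsRecurrent (N : AbelianNetwork V A Q) (q : ∀ v, Q v) : Prop :=
  q ∈ recurrentSet N.globalMonoid

/-- `q_v ∈ e_v Q_v` for all `v`, where `e_v` is the minimal idempotent of the local monoid. -/
def IsLocallyRecurrent (N : AbelianNetwork V A Q) (q : ∀ v, Q v) : Prop :=
  ∀ v, q v ∈ recurrentSet (N.proc v).transitionMonoid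

/-- Every processor of the network is irreducible. -/
def IsIrreducible (N : AbelianNetwork V A Q) : Prop :=
  ∀ v, IsIrreducibleAction (N.proc v).transitionMonoid

/-- The total kernel `K = ∏ K_v ⊆ ℤ^A`. -/
def totalKernel (N : AbelianNetwork V A Q) : AddSubgroup ((Σ v, A v) → ℤ) where
  carrier := {x | ∀ v, (fun a : A v => x ⟨v, a⟩) ∈ (N.proc v).kernel}
  zero_mem' := fun v => (N.proc v).kernel.zero_mem
  add_mem' := fun hx hy v => (N.proc v).kernel.add_mem (hx v) (hy v)
  neg_mem' := fun hx v => (N.proc v).kernel.neg_mem (hx v)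

/-- The reset number `r_a = min {m ≥ 1 : m 1_a ∈ K}`. -/
noncomputable def resetNumber (N : AbelianNetwork V A Q) (a : Σ v, A v) : ℕ :=
  sInf {m : ℕ | 1 ≤ m ∧ Pi.single a (m : ℤ) ∈ N.totalKernel}

/-- The local action `|w| ▷ q = π_w(|w|.q)`: the letters of `w` are added and processed. -/
def localAct (N : AbelianNetwork V A Q) (w : List (Σ v, A v)) (q : ∀ v, Q v) :
    ((Σ v, A v) → ℤ) × (∀ v, Q v) :=
  N.exec w (fun b => (w.count b : ℤ), q)

/-- The matrix of the production map `P_q`, for a locally recurrent state `q` (on which it does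
not depend if the network is irreducible). For `k ∈ K ∩ ℕ^A` one has `k ▷ q = P_q(k).q`, and
column `a` is `P_q(1_a) = (1 / r_a) P_q(r_a 1_a)`. -/
noncomputable def productionMatrix (N : AbelianNetwork V A Q) (q : ∀ v, Q v) :
    Matrix (Σ v, A v) (Σ v, A v) ℚ :=
  Matrix.of fun b a =>
    ((N.localAct (List.replicate (N.resetNumber a) a) q).1 b : ℚ) / (N.resetNumber a : ℚ)

/-- The diagonal matrix `D` of reset numbers. -/
noncomputable def resetMatrix (N : AbelianNetwork V A Q) : Matrix (Σ v, A v) (Σ v, A v) ℚ :=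
  Matrix.diagonal fun a => (N.resetNumber a : ℚ)

/-- The Laplacian `L = (I - P) D`. -/
noncomputable def laplacian [Fintype V] [∀ v, Fintype (A v)] (N : AbelianNetwork V A Q)
    (q : ∀ v, Q v) : Matrix (Σ v, A v) (Σ v, A v) ℚ :=
  (1 - N.productionMatrix q) * N.resetMatrix

/-- The production graph: there is an edge from `a` to `b` when `P_{ba} > 0`. -/
def productionGraph (N : AbelianNetwork V A Q) (q : ∀ v, Q v) : Digraph (Σ v, A v) where
  Adj a b := 0 < N.productionMatrix q b a

/-- The processor of the sandpilization at the letter `a`: it has a single input letter, counts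
modulo `r_a`, and when it passes from `r_a - 1` to `0` it sends `r_a P_{ba}` letters to each `b`. -/
noncomputable def sandpileProcessor (N : AbelianNetwork V A Q) (q : ∀ v, Q v) (a : Σ v, A v) :
    AbelianProcessor Unit (ZMod (N.resetNumber a)) (fun _ : (Σ v, A v) => Unit) where
  t := fun _ s => s + 1
  o := fun _ b s =>
    if s + 1 = 0 then
      List.replicate ⌊(N.resetNumber a : ℚ) * N.productionMatrix q b a⌋₊ ()
    else []
  t_comm := fun _ _ _ => rfl
  output_perm := fun w w' h s u => by
    have : w = w' := List.ext_getElem h.length_eq fun _ _ _ => rfl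
    rw [this]

/-- The sandpilization of the network, a unary network on the production graph. -/
noncomputable def sandpilization (N : AbelianNetwork V A Q) (q : ∀ v, Q v) :
    AbelianNetwork (Σ v, A v) (fun _ => Unit) (fun a => ZMod (N.resetNumber a)) where
  graph := N.productionGraph q
  proc := N.sandpileProcessor q
  message_nil := fun a b hab _ s => by
    have h : (N.resetNumber a : ℚ) * N.productionMatrix q b a ≤ 0 :=
      mul_nonpos_of_nonneg_of_nonpos (Nat.cast_nonneg _) (not_lt.mp hab)
    simp [sandpileProcessor, Nat.floor_of_nonpos h]

end AbelianNetwork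

/-- The digraph has a directed cycle `a_1 → ⋯ → a_m → a_1`, `m ≥ 1`, with distinct vertices. -/
def Digraph.HasDirectedCycle {W : Type*} (G : Digraph W) : Prop :=
  ∃ c : Cycle W, c ≠ Cycle.nil ∧ c.Nodup ∧ c.Chain G.Adj

/-! ### The locally recurrent states and the reset numbers exist -/

theorem exists_pow_idem {M : Type*} [Monoid M] [Finite M] (z : M) :
    ∃ n, z ^ (n + 1) * z ^ (n + 1) = z ^ (n + 1) := by
  obtain ⟨i, j, hne, hij⟩ := Finite.exists_ne_map_eq_of_infinite (fun n : ℕ => z ^ n)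
  wlog hlt : i < j generalizing i j with H
  · exact H j i hne.symm hij.symm (lt_of_le_of_ne (not_lt.mp hlt) hne.symm)
  obtain ⟨p, rfl⟩ := Nat.exists_eq_add_of_lt hlt
  have key : ∀ k m, i ≤ m → z ^ (m + k * (p + 1)) = z ^ m := by
    intro k m hm
    induction k with
    | zero => simp
    | succ k ih =>
      obtain ⟨d, rfl⟩ := Nat.exists_eq_add_of_le hm
      rw [← ih, show i + d + (k + 1) * (p + 1) = (i + p + 1) + (d + k * (p + 1)) by ring,
        pow_add, ← hij, ← pow_add]
      congr 1
      ring
  refine ⟨i * (p + 1) + p, ?_⟩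
  rw [← pow_add]
  have := key (i + 1) ((i + 1) * (p + 1)) (by nlinarith)
  convert this using 2 <;> ring

namespace AbelianProcessor
variable {I Q U : Type*} {B : U → Type*}

theorem exists_minimalIdempotent [Finite Q] (p : AbelianProcessor I Q B) :
    ∃ e, IsMinimalIdempotent p.transitionMonoid e := by
  have hc : ∀ a ∈ {f : Function.End Q | ∃ a : I, f = p.t a},
      ∀ b ∈ {f : Function.End Q | ∃ a : I, f = p.t a}, a * b = b * a := by
    rintro _ ⟨a, rfl⟩ _ ⟨b, rfl⟩
    exact funext fun q => p.t_comm a b q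
  have hi : IsMulCommutative p.transitionMonoid :=
    Submonoid.isMulCommutative_closure (Function.End Q) hc
  let _ : CommMonoid p.transitionMonoid :=
    { (inferInstance : Monoid p.transitionMonoid) with mul_comm := hi.is_comm.comm }
  have : Finite (Function.End Q) := inferInstanceAs (Finite (Q → Q))
  have : Fintype p.transitionMonoid := Fintype.ofFinite _
  obtain ⟨n, hn⟩ := exists_pow_idem (∏ m : p.transitionMonoid, m)
  set z := ∏ m : p.transitionMonoid, m with hz
  refine ⟨(z ^ (n + 1) : p.transitionMonoid), (z ^ (n + 1)).2, congrArg Subtype.val hn, ?_⟩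
  intro m hm
  obtain ⟨c, hcz⟩ := Finset.dvd_prod_of_mem (fun m : p.transitionMonoid => m)
    (Finset.mem_univ ⟨m, hm⟩)
  refine ⟨(z ^ n * c : p.transitionMonoid), (z ^ n * c).2, ?_⟩
  have : z ^ n * c * ⟨m, hm⟩ = z ^ (n + 1) := by
    rw [pow_succ, mul_assoc, mul_comm c, ← hcz]
  exact congrArg Subtype.val this

end AbelianProcessor

/-- Locally recurrent states exist. -/
theorem AbelianNetwork.exists_isLocallyRecurrent {V : Type*} {A Q : V → Type*}
    [∀ v, Finite (Q v)] (N : AbelianNetwork V A Q) (h : N.IsIrreducible) :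
    ∃ q, N.IsLocallyRecurrent q := by
  choose e he using fun v => (N.proc v).exists_minimalIdempotent
  exact ⟨fun v => e v (h v).1.some, fun v => ⟨e v, he v, (h v).1.some, rfl⟩⟩

/-- The set whose minimum is the reset number is nonempty. -/
theorem AbelianNetwork.one_le_resetNumber {V : Type*} {A Q : V → Type*} [DecidableEq V] [∀ v, DecidableEq (A v)]
    [∀ v, Finite (Q v)] (N : AbelianNetwork V A Q) (a : Σ v, A v) : 1 ≤ N.resetNumber a := by
  refine (Nat.sInf_mem (s := {m : ℕ | 1 ≤ m ∧ Pi.single a (m : ℤ) ∈ N.totalKernel}) ?_).1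
  obtain ⟨v, a⟩ := a
  obtain ⟨e, he⟩ := (N.proc v).exists_minimalIdempotent
  have : Finite (Function.End (Q v)) := inferInstanceAs (Finite (Q v → Q v))
  set T : Function.End (Q v) := (N.proc v).t a
  obtain ⟨n, hn⟩ := exists_pow_idem T
  have hT : T ∈ (N.proc v).transitionMonoid := Submonoid.subset_closure ⟨a, rfl⟩
  have hrun : ∀ k q, (N.proc v).run (List.replicate k a) q = (T ^ k) q := by
    intro k
    induction k with
    | zero => intro q; rfl
    | succ k ih => intro q; exact (ih _)
  refine ⟨n + 1, by omega, fun w => ?_⟩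
  by_cases hw : w = v
  · subst hw
    refine ⟨List.replicate (n + 1) a, [], fun b => ?_, ?_⟩
    · by_cases hb : a = b
      · subst hb; simp
      · simp [List.count_replicate, hb]
    · rintro _ ⟨f, hf, y, rfl⟩
      rw [hrun]
      obtain ⟨m', hm', hm⟩ := hf.2.2 _ (Submonoid.pow_mem _ hT (n + 1))
      change (T ^ (n + 1)) (f y) = f y
      have h1 : T ^ (n + 1) * f = f := by
        have hcomm : T ^ (n + 1) * f = f * T ^ (n + 1) := by
          funext q
          have := (N.proc w).comm_run hf.1 (List.replicate (n + 1) a) q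
          rw [hrun, hrun] at this
          exact this
        rw [hcomm]; nth_rw 1 [← hm]; rw [mul_assoc, hn, hm]
      exact congrFun h1 y
  · convert (N.proc w).kernel.zero_mem using 1
    funext b
    exact Pi.single_eq_of_ne (fun h => hw (congrArg Sigma.fst h)) _

/-! ### Words with prescribed letter counts -/

/-! All conditions are compared with (5), read as well-foundedness of the relation "`a` produces
`b`". The integer matrix `R = P D` and the reset numbers `r` govern both networks: `IsPeriodicOn`
holds for `N` on its locally recurrent states and for the sandpilization on all states, with the
same data. Each recurrence argument is therefore made once. Halting on a large input supplies a
vector `k` with `1 + R k ≤ r k` in every coordinate (`IsPeriodicOn.exists_subunital`); it drives the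
rest of the proof.

Put `y = r k - R k`, so `y ≥ 1`, and let `u` be a word with `r k` letters: from any state of the
invariant set, `u` returns to that state and consumes exactly `y` on balance. If production is
acyclic, the legal execution of `y.q` must use all of `u`, since a minimal unused letter would still
be waiting. So `y` fixes `q`, and `q` is recurrent (`IsPeriodicOn.isRecurrent`).

Conversely, for recurrent `q` the burning test `IsRecurrent.exists_isLegal` makes some rearrangement
of `u` legal for `y.q`. A minimal set closed under taking some predecessor carries a bijective
choice of predecessors. From a suitable state, processing each letter of this set once sends every
letter of the set. The state reached fails the test by the least action principle
(`IsPeriodicOn.not_isRecurrent`). In the sandpilization this state can be chosen to be `0`.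

On the matrix side, `P` is nonnegative and strictly decreases the positive vector `r k`, so `(1 -
P)⁻¹ ≥ 0` and `0 < det (1 - P) ≤ 1`. A cycle makes a diagonal entry of the inverse exceed `1`, which
is incompatible with determinant `1`. Acyclicity gives nilpotency, and nilpotency gives determinant
`1`. -/

theorem List.exists_forall_count_eq {α : Type*} [DecidableEq α] [Fintype α] (c : α → ℕ) :
    ∃ w : List α, ∀ a, w.count a = c a := by
  refine ⟨(∑ a, Multiset.replicate (c a) a).toList, fun a => ?_⟩
  rw [← Multiset.coe_count, Multiset.coe_toList, Multiset.count_sum']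
  simp [Multiset.count_replicate]

theorem List.exists_perm_append_of_count_le {α : Type*} [DecidableEq α] {w w' : List α}
    (h : ∀ a, w.count a ≤ w'.count a) : ∃ z, w'.Perm (w ++ z) := by
  have h' : (w : Multiset α) ≤ w' := Multiset.le_iff_count.2 fun a => by simpa using h a
  obtain ⟨u, hu⟩ := Multiset.le_iff_exists_add.1 h'
  refine ⟨u.toList, Multiset.coe_eq_coe.1 ?_⟩
  rw [hu, ← Multiset.coe_add, Multiset.coe_toList]

namespace AbelianNetwork

variable {V : Type*} {A Q : V → Type*} [DecidableEq V]

/-! ### Executions -/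

/-- The state of the network after processing the letter `a`. -/
def move (N : AbelianNetwork V A Q) (a : Σ v, A v) (q : ∀ v, Q v) : ∀ v, Q v :=
  Function.update q a.1 ((N.proc a.1).t a.2 (q a.1))

/-- The state of the network after processing the word `w`. -/
def finalState (N : AbelianNetwork V A Q) : List (Σ v, A v) → (∀ v, Q v) → ∀ v, Q v
  | [], q => q
  | a :: w, q => finalState N w (N.move a q)

theorem finalState_append (N : AbelianNetwork V A Q) (w w' : List (Σ v, A v)) (q : ∀ v, Q v) :
    N.finalState (w ++ w') q = N.finalState w' (N.finalState w q) := by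
  induction w generalizing q with
  | nil => rfl
  | cons a w ih => exact ih _

theorem move_comm (N : AbelianNetwork V A Q) (a b : Σ v, A v) (q : ∀ v, Q v) :
    N.move a (N.move b q) = N.move b (N.move a q) := by
  obtain ⟨v, a⟩ := a
  obtain ⟨u, b⟩ := b
  by_cases h : v = u
  · subst h
    simp [move, (N.proc v).t_comm a b]
  · simp only [move, Function.update_of_ne h, Function.update_of_ne (Ne.symm h)]
    exact Function.update_comm (Ne.symm h) _ _ _

theorem finalState_perm (N : AbelianNetwork V A Q) {w w' : List (Σ v, A v)} (h : w.Perm w')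
    (q : ∀ v, Q v) : N.finalState w q = N.finalState w' q := by
  induction h generalizing q with
  | nil => rfl
  | cons a _ ih => exact ih _
  | swap a b w => simp only [finalState, N.move_comm a b]
  | trans _ _ ih ih' => rw [ih, ih']

variable [∀ v, DecidableEq (A v)]

/-- The number of letters `b` sent when the word `w` is processed starting from `q`. -/
def sent (N : AbelianNetwork V A Q) : List (Σ v, A v) → (∀ v, Q v) → (Σ v, A v) → ℕ
  | [], _, _ => 0
  | a :: w, q, b => ((N.proc a.1).o a.2 b.1 (q a.1)).count b.2 + sent N w (N.move a q) b

/-- Messages and state changes do not depend on which letters are waiting. This separation turns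
later statements about executions into linear arithmetic in `count` and `sent`. -/
theorem exec_eq (N : AbelianNetwork V A Q) (w : List (Σ v, A v))
    (s : ((Σ v, A v) → ℤ) × (∀ v, Q v)) :
    N.exec w s = (fun b => s.1 b - w.count b + N.sent w s.2 b, N.finalState w s.2) := by
  induction w generalizing s with
  | nil => simp [exec, sent, finalState]
  | cons a w ih =>
    rw [exec, ih]
    refine Prod.ext (funext fun b => ?_) rfl
    simp only [step, sent, move, List.count_cons, beq_iff_eq, eq_comm (a := a)]
    push_cast
    ring

theorem sent_append (N : AbelianNetwork V A Q) (w w' : List (Σ v, A v)) (q : ∀ v, Q v)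
    (b : Σ v, A v) :
    N.sent (w ++ w') q b = N.sent w q b + N.sent w' (N.finalState w q) b := by
  induction w generalizing q with
  | nil => simp [sent, finalState]
  | cons a w ih => simp only [List.cons_append, sent, finalState, ih, add_assoc]

theorem exec_append (N : AbelianNetwork V A Q) (w w' : List (Σ v, A v))
    (s : ((Σ v, A v) → ℤ) × (∀ v, Q v)) :
    N.exec (w ++ w') s = N.exec w' (N.exec w s) := by
  induction w generalizing s with
  | nil => rfl
  | cons a w ih => exact ih _

theorem isLegal_append (N : AbelianNetwork V A Q) (w w' : List (Σ v, A v))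
    (s : ((Σ v, A v) → ℤ) × (∀ v, Q v)) :
    N.IsLegal (w ++ w') s ↔ N.IsLegal w s ∧ N.IsLegal w' (N.exec w s) := by
  induction w generalizing s with
  | nil => simp [IsLegal, exec]
  | cons a w ih => simp only [List.cons_append, IsLegal, ih, exec, and_assoc]

/-- At one vertex this is the abelian property for two-letter words; at distinct vertices neither
letter affects the state read by the other. -/
theorem sent_pair_comm (N : AbelianNetwork V A Q) (a b : Σ v, A v) (q : ∀ v, Q v)
    (c : Σ v, A v) : N.sent [a, b] q c = N.sent [b, a] q c := by
  obtain ⟨v, a⟩ := a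
  obtain ⟨u, b⟩ := b
  by_cases h : v = u
  · subst h
    have := ((N.proc v).output_perm [a, b] [b, a] (List.Perm.swap _ _ _) (q v) c.1).count_eq c.2
    simpa [Processor.output, sent, move] using this
  · simp only [sent, move, Function.update_of_ne h, Function.update_of_ne (Ne.symm h)]
    omega

theorem sent_perm (N : AbelianNetwork V A Q) {w w' : List (Σ v, A v)} (h : w.Perm w')
    (q : ∀ v, Q v) (c : Σ v, A v) : N.sent w q c = N.sent w' q c := by
  induction h generalizing q with
  | nil => rfl
  | cons a _ ih => simp only [sent, ih]
  | swap a b w =>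
    have := N.sent_pair_comm a b q c
    simp only [sent, N.move_comm a b] at this ⊢
    omega
  | trans _ _ ih ih' => rw [ih, ih']

theorem sent_mono (N : AbelianNetwork V A Q) {w w' : List (Σ v, A v)}
    (h : ∀ a, w.count a ≤ w'.count a) (q : ∀ v, Q v) (b : Σ v, A v) :
    N.sent w q b ≤ N.sent w' q b := by
  obtain ⟨z, hz⟩ := List.exists_perm_append_of_count_le h
  rw [N.sent_perm hz, sent_append]
  exact Nat.le_add_right _ _

/-! ### Legal executions and the least action principle -/

theorem IsLegal.mono {N : AbelianNetwork V A Q} {w : List (Σ v, A v)}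
    {x y : (Σ v, A v) → ℤ} {q : ∀ v, Q v} (hxy : x ≤ y) (h : N.IsLegal w (x, q)) :
    N.IsLegal w (y, q) := by
  induction w generalizing x y q with
  | nil => trivial
  | cons a w ih =>
    refine ⟨h.1.trans (hxy a), ih (fun b => ?_) h.2⟩
    have := hxy b
    dsimp only
    linarith

theorem IsLegal.exec_nonneg {N : AbelianNetwork V A Q} {w : List (Σ v, A v)}
    {s : ((Σ v, A v) → ℤ) × (∀ v, Q v)} (h : N.IsLegal w s) (hs : 0 ≤ s.1) :
    0 ≤ (N.exec w s).1 := by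
  induction w generalizing s with
  | nil => exact hs
  | cons a w ih =>
    refine ih h.2 fun b => ?_
    have h0 := hs b
    have h1 := h.1
    simp only [step, Pi.zero_apply] at h0 ⊢
    by_cases hb : b = a
    · subst hb
      simp only [if_true]
      omega
    · simp only [if_neg hb]
      omega

theorem isLegal_of_count_le (N : AbelianNetwork V A Q) {w : List (Σ v, A v)}
    {x : (Σ v, A v) → ℤ} (h : ∀ a, (w.count a : ℤ) ≤ x a) (q : ∀ v, Q v) :
    N.IsLegal w (x, q) := by
  induction w generalizing x q with
  | nil => trivial
  | cons a w ih =>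
    refine ⟨?_, ih (fun b => ?_) _⟩
    · have := h a
      rw [List.count_cons_self] at this
      push_cast at this
      dsimp only
      omega
    · have := h b
      rw [List.count_cons] at this
      by_cases hb : b = a
      · subst hb
        simp only [beq_self_eq_true, if_true] at this ⊢
        push_cast at this
        omega
      · simp only [beq_iff_eq, Ne.symm hb, hb, if_false] at this ⊢
        omega

/-- The least action principle, relative to the letters `b` for which `c` is complete. -/
theorem IsLegal.count_le {N : AbelianNetwork V A Q} {z c : List (Σ v, A v)}
    {s : ((Σ v, A v) → ℤ) × (∀ v, Q v)} (hz : N.IsLegal z s)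
    (hc : ∀ b, (N.exec c s).1 b ≤ 0 ∨ z.count b ≤ c.count b) (b : Σ v, A v) :
    z.count b ≤ c.count b := by
  induction z using List.reverseRecOn generalizing b with
  | nil => simp
  | append_singleton z a ih =>
    rw [isLegal_append] at hz
    have ih' := ih hz.1 fun b => (hc b).imp_right fun h => le_trans (by simp) h
    by_cases hb : b = a
    · subst hb
      rcases hc b with h | h
      -- A letter `b` is present after `z`, none is left after `c`, and `c` sends at least as many
      -- `b` as `z`; so `c` has processed strictly more of them.
      · have h1 := hz.2.1
        have h2 := N.sent_mono ih' s.2 b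
        rw [exec_eq] at h h1
        dsimp only at h h1
        have h3 := ih' b
        simp only [List.count_append, List.count_singleton_self]
        omega
      · exact h
    · simpa [List.count_append, List.count_singleton, Ne.symm hb] using ih' b

theorem count_eq_of_isLegal_of_isComplete (N : AbelianNetwork V A Q) {w w' : List (Σ v, A v)}
    {s : ((Σ v, A v) → ℤ) × (∀ v, Q v)} (hw : N.IsLegal w s) (hc : N.IsComplete w s)
    (hw' : N.IsLegal w' s) (hc' : N.IsComplete w' s) (b : Σ v, A v) : w.count b = w'.count b :=
  le_antisymm (hw.count_le (fun b => Or.inl (hc' b)) b) (hw'.count_le (fun b => Or.inl (hc b)) b)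

/-- The word `c` need not be legal. By least action it bounds the length of every legal word, so
greedy processing must stop. -/
theorem haltsOn_of_isComplete [Fintype V] [∀ v, Fintype (A v)] (N : AbelianNetwork V A Q)
    {x : (Σ v, A v) → ℕ} {q : ∀ v, Q v} {c : List (Σ v, A v)}
    (hc : N.IsComplete c (fun a => (x a : ℤ), q)) : N.HaltsOn x q := by
  by_contra h
  have key : ∀ n : ℕ, ∃ w : List (Σ v, A v), w.length = n ∧
      N.IsLegal w (fun a => (x a : ℤ), q) := by
    intro n
    induction n with
    | zero => exact ⟨[], rfl, trivial⟩
    | succ n ih =>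
      obtain ⟨w, hn, hw⟩ := ih
      have : ¬ N.IsComplete w (fun a => (x a : ℤ), q) := fun hw' => h ⟨w, hw, hw'⟩
      simp only [IsComplete, Pi.le_def, not_forall, not_le, Pi.zero_apply] at this
      obtain ⟨a, ha⟩ := this
      refine ⟨w ++ [a], by simp [hn], ?_⟩
      rw [isLegal_append]
      exact ⟨hw, ha, trivial⟩
  obtain ⟨w, hn, hw⟩ := key (c.length + 1)
  obtain ⟨z, hz⟩ := List.exists_perm_append_of_count_le
    (hw.count_le fun b => Or.inl (hc b))
  have := hz.length_eq
  simp only [List.length_append] at this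
  omega

/-! ### The global action -/

theorem globalAct_eq (N : AbelianNetwork V A Q) {x : (Σ v, A v) → ℕ} {q : ∀ v, Q v}
    {w : List (Σ v, A v)} (hw : N.IsLegal w (fun a => (x a : ℤ), q))
    (hc : N.IsComplete w (fun a => (x a : ℤ), q)) : N.globalAct x q = N.finalState w q := by
  have h : N.HaltsOn x q := ⟨w, hw, hc⟩
  rw [globalAct, dif_pos h, exec_eq]
  exact N.finalState_perm (List.perm_iff_count.2 fun a =>
    N.count_eq_of_isLegal_of_isComplete h.choose_spec.1 h.choose_spec.2 hw hc a) q

theorem isLegal_isComplete_append (N : AbelianNetwork V A Q) {x y : (Σ v, A v) → ℕ}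
    {q : ∀ v, Q v} {w w' : List (Σ v, A v)} (hw : N.IsLegal w (fun a => (x a : ℤ), q))
    (hc : N.IsComplete w (fun a => (x a : ℤ), q))
    (hw' : N.IsLegal w' (fun a => (y a : ℤ), N.finalState w q))
    (hc' : N.IsComplete w' (fun a => (y a : ℤ), N.finalState w q)) :
    N.IsLegal (w ++ w') (fun a => ((x + y) a : ℤ), q) ∧
      N.IsComplete (w ++ w') (fun a => ((x + y) a : ℤ), q) := by
  have h0 : 0 ≤ (N.exec w (fun a => (x a : ℤ), q)).1 := hw.exec_nonneg fun a => by simp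
  have h1 : N.exec w (fun a => ((x + y) a : ℤ), q) =
      (fun a => (y a : ℤ), N.finalState w q) := by
    have h2 := le_antisymm hc h0
    rw [exec_eq] at h2 ⊢
    refine Prod.ext (funext fun b => ?_) rfl
    have := congrFun h2 b
    simp only [Pi.zero_apply, Pi.add_apply] at this ⊢
    push_cast
    linarith
  rw [isLegal_append, IsComplete, exec_append, h1]
  exact ⟨⟨hw.mono fun a => by simp, hw'⟩, hc'⟩

theorem globalAct_zero (N : AbelianNetwork V A Q) (q : ∀ v, Q v) : N.globalAct 0 q = q :=
  N.globalAct_eq (w := []) trivial fun a => by simp [exec]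

theorem globalAct_add {N : AbelianNetwork V A Q} (hN : N.HaltsOnAllInputs)
    (x y : (Σ v, A v) → ℕ) (q : ∀ v, Q v) :
    N.globalAct (x + y) q = N.globalAct y (N.globalAct x q) := by
  obtain ⟨w, hw, hc⟩ := hN x q
  obtain ⟨w', hw', hc'⟩ := hN y (N.finalState w q)
  obtain ⟨h, h'⟩ := N.isLegal_isComplete_append hw hc hw' hc'
  rw [N.globalAct_eq h h', N.globalAct_eq hw hc, N.globalAct_eq hw' hc', finalState_append]

theorem exists_globalAct_of_mem {N : AbelianNetwork V A Q} (hN : N.HaltsOnAllInputs)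
    {m : Function.End (∀ v, Q v)} (hm : m ∈ N.globalMonoid) : ∃ x, m = N.globalAct x := by
  induction hm using Submonoid.closure_induction with
  | mem f hf => obtain ⟨a, rfl⟩ := hf; exact ⟨_, rfl⟩
  | one => exact ⟨0, funext fun q => (N.globalAct_zero q).symm⟩
  | mul f g _ _ hf hg =>
    obtain ⟨x, rfl⟩ := hf
    obtain ⟨y, rfl⟩ := hg
    exact ⟨y + x, funext fun q => (globalAct_add hN y x q).symm⟩

theorem globalAct_mem [Fintype V] [∀ v, Fintype (A v)] {N : AbelianNetwork V A Q}
    (hN : N.HaltsOnAllInputs) (x : (Σ v, A v) → ℕ) : N.globalAct x ∈ N.globalMonoid := by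
  obtain ⟨w, hw⟩ := List.exists_forall_count_eq x
  obtain rfl : (fun a => w.count a) = x := funext hw
  clear hw
  induction w with
  | nil =>
    have : N.globalAct (fun b => List.count b []) = (1 : Function.End (∀ v, Q v)) :=
      funext fun q => N.globalAct_zero q
    rw [this]
    exact N.globalMonoid.one_mem
  | cons a w ih =>
    have : N.globalAct (fun b => (a :: w).count b) =
        (HMul.hMul (α := Function.End (∀ v, Q v)) (β := Function.End (∀ v, Q v))
          (N.globalAct fun b => w.count b) (N.globalAct (Pi.single a 1))) := by
      funext q
      change _ = N.globalAct _ (N.globalAct _ q)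
      rw [← globalAct_add hN]
      congr 1
      funext b
      simp [List.count_cons, Pi.single_apply, eq_comm (a := b), add_comm]
    rw [this]
    exact N.globalMonoid.mul_mem ih (Submonoid.subset_closure ⟨a, rfl⟩)

/-- The global action of a network that halts on all inputs, as a processor without output. -/
noncomputable def globalProcessor (N : AbelianNetwork V A Q) (hN : N.HaltsOnAllInputs) :
    AbelianProcessor (Σ v, A v) (∀ v, Q v) (fun _ : Empty => Empty) where
  t := fun a q => N.globalAct (Pi.single a 1) q
  o := fun _ u _ => u.elim
  t_comm := fun a b q => by rw [← globalAct_add hN, ← globalAct_add hN, add_comm]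
  output_perm := fun _ _ _ _ u => u.elim

/-! ### Recurrent states -/

/-- If the minimal idempotent is the action of `x`, some multiple of `y` dominates `x` and still
fixes `q`; hence `q` lies in the image of the idempotent. -/
theorem isRecurrent_of_globalAct_eq [Fintype V] [∀ v, Fintype (A v)] [∀ v, Finite (Q v)]
    {N : AbelianNetwork V A Q} (hN : N.HaltsOnAllInputs) {y : (Σ v, A v) → ℕ} {q : ∀ v, Q v}
    (hy : ∀ a, 1 ≤ y a) (hq : N.globalAct y q = q) : N.IsRecurrent q := by
  obtain ⟨e, he⟩ := (N.globalProcessor hN).exists_minimalIdempotent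
  obtain ⟨x, rfl⟩ := exists_globalAct_of_mem hN he.1
  refine ⟨_, he, ?_⟩
  have hn : ∀ n : ℕ, N.globalAct (n • y) q = q := by
    intro n
    induction n with
    | zero => rw [zero_smul, globalAct_zero]
    | succ n ih => rw [succ_nsmul, globalAct_add hN, ih, hq]
  have hle : x ≤ (∑ a, x a) • y := fun a => by
    have h1 : x a ≤ ∑ a, x a := Finset.single_le_sum (fun _ _ => Nat.zero_le _) (Finset.mem_univ a)
    simpa using Nat.mul_le_mul h1 (hy a)
  refine ⟨N.globalAct ((∑ a, x a) • y - x) q, ?_⟩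
  rw [← globalAct_add hN, tsub_add_cancel_of_le hle, hn]

/-- The minimal idempotent fixes `q` and factors through the action of `k`, so it is the action of
some vector above `k`. -/
theorem IsRecurrent.exists_globalAct_eq [Fintype V] [∀ v, Fintype (A v)]
    {N : AbelianNetwork V A Q} (hN : N.HaltsOnAllInputs) {q : ∀ v, Q v} (hq : N.IsRecurrent q)
    (k : (Σ v, A v) → ℕ) : ∃ x, k ≤ x ∧ N.globalAct x q = q := by
  obtain ⟨e, he, y, rfl⟩ := hq
  obtain ⟨m, hm, hme⟩ := he.2.2 _ (globalAct_mem hN k)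
  obtain ⟨x, rfl⟩ := exists_globalAct_of_mem hN hm
  refine ⟨k + x, le_self_add, ?_⟩
  rw [globalAct_add hN]
  exact (congrFun hme (e y)).trans (congrFun he.2.1 y)

/-- The burning test: if the word `k` returns the recurrent state `q` to itself and consumes
exactly the letters `y` on balance, then `k` can be rearranged to a legal execution of `y.q`. -/
theorem IsRecurrent.exists_isLegal [Fintype V] [∀ v, Fintype (A v)]
    {N : AbelianNetwork V A Q} (hN : N.HaltsOnAllInputs) {q : ∀ v, Q v} (hq : N.IsRecurrent q)
    {k : List (Σ v, A v)} (hk : N.finalState k q = q) {y : (Σ v, A v) → ℕ}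
    (hy : ∀ b, y b + N.sent k q b = k.count b) :
    ∃ z, N.IsLegal z (fun a => (y a : ℤ), q) ∧ ∀ b, z.count b = k.count b := by
  obtain ⟨x, hkx, hx⟩ := hq.exists_globalAct_eq hN (fun b => k.count b)
  obtain ⟨z, hz, hzc⟩ := hN y q
  obtain ⟨w, hw, hwc⟩ := hN x q
  rw [N.globalAct_eq hw hwc] at hx
  refine ⟨z, hz, fun b => ?_⟩
  -- Two complete legal executions of `(x + y).q` are compared: `w ++ z`, and `k ++ w`, where `k` is
  -- legal because `x ≥ k` and leaves exactly `x.q`. Equal letter counts give those of `z` and `k`.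
  obtain ⟨h1, h2⟩ := N.isLegal_isComplete_append hw hwc (hx.symm ▸ hz) (hx.symm ▸ hzc)
  have hex : N.exec k (fun a => ((x + y) a : ℤ), q) = (fun a => (x a : ℤ), q) := by
    rw [exec_eq]
    refine Prod.ext (funext fun b => ?_) hk
    have := hy b
    simp only [Pi.add_apply]
    push_cast
    omega
  have h3 : N.IsLegal (k ++ w) (fun a => ((x + y) a : ℤ), q) := by
    rw [isLegal_append, hex]
    refine ⟨N.isLegal_of_count_le (fun a => ?_) q, hw⟩
    have := hkx a
    simp only [Pi.add_apply] at this ⊢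
    push_cast
    omega
  have h4 : N.IsComplete (k ++ w) (fun a => ((x + y) a : ℤ), q) := by
    rw [IsComplete, exec_append, hex]
    exact hwc
  have := N.count_eq_of_isLegal_of_isComplete h1 h2 h3 h4 b
  simp only [List.count_append] at this
  omega

end AbelianNetwork

namespace AbelianNetwork

variable {V : Type*} {A Q : V → Type*} [DecidableEq V] [∀ v, DecidableEq (A v)]

/-! ### Periodic production -/

/-- On the invariant set `S` of states, the word `a ^ r_a` returns every state to itself and sends
`R_{ba}` letters `b`. -/
structure IsPeriodicOn (N : AbelianNetwork V A Q) (S : Set (∀ v, Q v)) (r : (Σ v, A v) → ℕ)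
    (R : Matrix (Σ v, A v) (Σ v, A v) ℕ) : Prop where
  one_le : ∀ a, 1 ≤ r a
  move_mem : ∀ q ∈ S, ∀ a, N.move a q ∈ S
  finalState_replicate : ∀ q ∈ S, ∀ a, N.finalState (List.replicate (r a) a) q = q
  sent_replicate : ∀ q ∈ S, ∀ a b, N.sent (List.replicate (r a) a) q b = R b a

namespace IsPeriodicOn

variable {N : AbelianNetwork V A Q} {S : Set (∀ v, Q v)} {r : (Σ v, A v) → ℕ}
  {R : Matrix (Σ v, A v) (Σ v, A v) ℕ} {q : ∀ v, Q v}

theorem finalState_mem (h : N.IsPeriodicOn S r R) (hq : q ∈ S) (w : List (Σ v, A v)) :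
    N.finalState w q ∈ S := by
  induction w generalizing q with
  | nil => exact hq
  | cons a w ih => exact ih (h.move_mem q hq a)

/-- One letter `a` sends no more than the whole period `a ^ r a` starting with it. -/
theorem sent_eq_zero (h : N.IsPeriodicOn S r R) (hq : q ∈ S) {b : Σ v, A v}
    {w : List (Σ v, A v)} (hw : ∀ a ∈ w, R b a = 0) : N.sent w q b = 0 := by
  induction w generalizing q with
  | nil => rfl
  | cons a w ih =>
    have h1 := N.sent_append [a] w q b
    rw [List.singleton_append] at h1
    have h2 : N.sent [a] q b ≤ N.sent (List.replicate (r a) a) q b := by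
      refine N.sent_mono (fun c => ?_) q b
      have := h.one_le a
      rw [List.count_replicate, List.count_singleton]
      split <;> omega
    rw [h.sent_replicate q hq, hw a List.mem_cons_self] at h2
    rw [h1, ih (h.finalState_mem hq [a]) fun c hc => hw c (List.mem_cons_of_mem _ hc)]
    omega

variable [Fintype V] [∀ v, Fintype (A v)]

theorem finalState_and_sent_of_count (h : N.IsPeriodicOn S r R) (hq : q ∈ S)
    {k : (Σ v, A v) → ℕ} {w : List (Σ v, A v)} (hw : ∀ a, w.count a = r a * k a) :
    N.finalState w q = q ∧ ∀ b, N.sent w q b = ∑ a, R b a * k a := by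
  obtain ⟨l, hl⟩ := List.exists_forall_count_eq k
  have key : ∀ l : List (Σ v, A v),
      (∀ a, (l.flatMap fun a => List.replicate (r a) a).count a = r a * l.count a) ∧
      N.finalState (l.flatMap fun a => List.replicate (r a) a) q = q ∧
      ∀ b, N.sent (l.flatMap fun a => List.replicate (r a) a) q b =
        ∑ a, R b a * l.count a := by
    intro l
    induction l with
    | nil => simp [finalState, sent]
    | cons c l ih =>
      obtain ⟨h1, h2, h3⟩ := ih
      refine ⟨fun a => ?_, ?_, fun b => ?_⟩
      · rw [List.flatMap_cons, List.count_append, h1, List.count_replicate, List.count_cons]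
        by_cases hca : c = a
        · subst hca
          simp only [beq_self_eq_true, if_true]
          ring
        · simp [hca]
      · rw [List.flatMap_cons, finalState_append, h.finalState_replicate q hq, h2]
      · rw [List.flatMap_cons, sent_append, h.finalState_replicate q hq, h.sent_replicate q hq,
          h3]
        simp [List.count_cons, mul_add, Finset.sum_add_distrib, add_comm]
  obtain ⟨h1, h2, h3⟩ := key l
  have hp : w.Perm (l.flatMap fun a => List.replicate (r a) a) :=
    List.perm_iff_count.2 fun a => by rw [hw, h1, hl]
  refine ⟨(N.finalState_perm hp q).trans h2, fun b => ?_⟩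
  rw [N.sent_perm hp, h3]
  simp only [hl]

/-- Halting on a large input forces the production to be strictly subunital on some vector. -/
theorem exists_subunital (h : N.IsPeriodicOn S r R) (hq : q ∈ S) (hN : N.HaltsOnAllInputs) :
    ∃ k : (Σ v, A v) → ℕ, ∀ b, 1 + ∑ a, R b a * k a ≤ r b * k b := by
  -- Rounding the counts of `w` down to multiples of `r` loses at most `r a - 1` letters `a`, fewer
  -- than the input provides.
  obtain ⟨w, -, hc⟩ := hN (fun a => r a + 1) q
  refine ⟨fun a => w.count a / r a, fun b => ?_⟩
  obtain ⟨z, hz⟩ := List.exists_forall_count_eq fun a => r a * (w.count a / r a)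
  have h1 := (h.finalState_and_sent_of_count hq hz).2 b
  have h2 := N.sent_mono (fun a => (hz a).trans_le (Nat.mul_div_le _ _)) q b
  have h3 := hc b
  have h4 := Nat.div_add_mod (w.count b) (r b)
  have h5 := Nat.mod_lt (w.count b) (h.one_le b)
  rw [exec_eq] at h3
  simp only [Pi.zero_apply] at h3
  push_cast at h3
  dsimp only at h1 ⊢
  omega

/-- The vector `k` scaled by the total input gives a complete word, possibly illegal, from every
state. -/
theorem haltsOnAllInputs (h : N.IsPeriodicOn Set.univ r R) {k : (Σ v, A v) → ℕ}
    (hk : ∀ b, 1 + ∑ a, R b a * k a ≤ r b * k b) : N.HaltsOnAllInputs := by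
  intro x q
  obtain ⟨w, hw⟩ := List.exists_forall_count_eq fun a => r a * ((∑ c, x c) * k a)
  refine N.haltsOn_of_isComplete (c := w) fun b => ?_
  have h1 := (h.finalState_and_sent_of_count (Set.mem_univ q) hw).2 b
  have h2 : x b ≤ ∑ c, x c :=
    Finset.single_le_sum (fun _ _ => Nat.zero_le _) (Finset.mem_univ b)
  have h3 := Nat.mul_le_mul_left (∑ c, x c) (hk b)
  have h4 : ∑ a, R b a * ((∑ c, x c) * k a) = (∑ c, x c) * ∑ a, R b a * k a := by
    rw [Finset.mul_sum]
    exact Finset.sum_congr rfl fun a _ => by ring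
  have h5 : r b * ((∑ c, x c) * k b) = (∑ c, x c) * (r b * k b) := by ring
  rw [mul_add, mul_one] at h3
  rw [exec_eq]
  simp only [Pi.zero_apply]
  rw [h1, hw, h4, h5]
  omega

/-- If the production is acyclic then all states of the invariant set are recurrent. -/
theorem isRecurrent [∀ v, Finite (Q v)] (h : N.IsPeriodicOn S r R) (hN : N.HaltsOnAllInputs)
    {k : (Σ v, A v) → ℕ} (hk : ∀ b, 1 + ∑ a, R b a * k a ≤ r b * k b)
    (hwf : WellFounded fun a b => 0 < R b a) (hq : q ∈ S) : N.IsRecurrent q := by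
  obtain ⟨w, hw⟩ := List.exists_forall_count_eq fun a => r a * k a
  obtain ⟨hwq, hws⟩ := h.finalState_and_sent_of_count hq hw
  have hy : ∀ b, 1 ≤ r b * k b - ∑ a, R b a * k a := fun b => by have := hk b; omega
  refine isRecurrent_of_globalAct_eq hN hy ?_
  obtain ⟨c, hc, hcc⟩ := hN (fun b => r b * k b - ∑ a, R b a * k a) q
  rw [N.globalAct_eq hc hcc]
  have hle : ∀ b, c.count b ≤ w.count b := hc.count_le fun b => Or.inl <| by
    have := hk b
    rw [exec_eq]
    simp only
    rw [hw, hws]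
    omega
  obtain ⟨d, hd⟩ := List.exists_perm_append_of_count_le hle
  have hcount : ∀ b, w.count b = c.count b + d.count b := fun b => by
    rw [hd.count_eq, List.count_append]
  suffices hd0 : d = [] by
    rw [hd0, List.append_nil] at hd
    rw [← N.finalState_perm hd, hwq]
  by_contra hne
  -- No letter of `d` produces the minimal letter `b`, so `c` has already sent all the `b` that `w`
  -- sends. Then exactly `d.count b > 0` copies remain after `c`, against completeness.
  obtain ⟨b, hb, hmin⟩ := hwf.has_min {b | b ∈ d} (List.exists_mem_of_ne_nil d hne)
  have h1 : N.sent d (N.finalState c q) b = 0 :=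
    h.sent_eq_zero (h.finalState_mem hq c) fun a ha => Nat.eq_zero_of_not_pos (hmin a ha)
  have h2 := N.sent_perm hd q b
  rw [sent_append, h1, hws] at h2
  have h3 := hcc b
  rw [exec_eq] at h3
  simp only [Pi.zero_apply] at h3
  have h4 := hcount b
  have h5 := List.count_pos_iff.2 hb
  have h6 := hk b
  rw [hw] at h4
  omega

/-- A state reached by a word each of whose letters is sent along the way is not recurrent. -/
theorem not_isRecurrent (h : N.IsPeriodicOn S r R) (hN : N.HaltsOnAllInputs)
    {k : (Σ v, A v) → ℕ} (hk : ∀ b, 1 + ∑ a, R b a * k a ≤ r b * k b) (hq : q ∈ S)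
    {w : List (Σ v, A v)} (hne : w ≠ []) (hnd : w.Nodup) (hw : ∀ b ∈ w, 1 ≤ N.sent w q b) :
    ¬ N.IsRecurrent (N.finalState w q) := by
  intro hrec
  obtain ⟨u, hu⟩ := List.exists_forall_count_eq fun a => r a * k a
  have hwu : ∀ b, w.count b ≤ u.count b := fun b => by
    rw [hu]
    have := List.nodup_iff_count_le_one.1 hnd b
    have := hk b
    omega
  obtain ⟨c, hc⟩ := List.exists_perm_append_of_count_le hwu
  obtain ⟨h1, h2⟩ := h.finalState_and_sent_of_count (h.finalState_mem hq w) hu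
  obtain ⟨z, hz, hzu⟩ := hrec.exists_isLegal hN h1
    (y := fun b => r b * k b - ∑ a, R b a * k a) fun b => by
      have := hk b
      rw [h2, hu]
      omega
  have hcount : ∀ b, u.count b = w.count b + c.count b := fun b => by
    rw [hc.count_eq, List.count_append]
  -- For `b` in `w`, executing `c` on `y` leaves `1 - N.sent w q b ≤ 0` copies; for other letters
  -- `c` has as many as `u`. The relative form of least action thus applies, although `c` is too
  -- short on the letters of `w`.
  have hzc : ∀ b, z.count b ≤ c.count b := hz.count_le fun b => by
    by_cases hb : b ∈ w
    · left
      have h3 := hcount b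
      have h4 := hw b hb
      have h5 := (h.finalState_and_sent_of_count hq hu).2 b
      have h6 := hk b
      have h7 := List.nodup_iff_count_le_one.1 hnd b
      rw [N.sent_perm hc, sent_append] at h5
      rw [hu] at h3
      rw [exec_eq]
      simp only
      omega
    · right
      have h3 := hcount b
      rw [List.count_eq_zero_of_not_mem hb] at h3
      rw [hzu]
      omega
  obtain ⟨b, hb⟩ := List.exists_mem_of_ne_nil w hne
  have h3 := hzc b
  have h4 := hcount b
  have h5 := List.count_pos_iff.2 hb
  rw [hzu] at h3
  omega

end IsPeriodicOn

end AbelianNetwork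

/-! ### Directed cycles -/

/-- In a finite digraph with a directed cycle there is a nonempty set of vertices with a bijective
choice of predecessors in which no vertex has a second predecessor. -/
theorem Digraph.exists_bijOn_predecessor {W : Type*} [Finite W] {G : Digraph W}
    (h : ¬ WellFounded G.Adj) : ∃ (C : Finset W) (p : W → W), C.Nonempty ∧
      Set.BijOn p C C ∧ ∀ a ∈ C, ∀ b ∈ C, G.Adj a b ↔ a = p b := by
  classical
  have hex : ∃ C : Finset W, C.Nonempty ∧ ∀ b ∈ C, ∃ a ∈ C, G.Adj a b := by
    rw [WellFounded.wellFounded_iff_has_min] at h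
    push Not at h
    obtain ⟨s, hs, hs'⟩ := h
    refine ⟨s.toFinite.toFinset, by simpa using hs, fun b hb => ?_⟩
    simpa using hs' b (by simpa using hb)
  -- The image of any choice of predecessors inside `C` is closed in the same sense, so by
  -- minimality it is all of `C`. This forces bijectivity, and a second predecessor `a` of `b` would
  -- allow a choice whose image misses `p b`.
  obtain ⟨C, hC⟩ := exists_minimal_of_wellFoundedLT
    (fun C : Finset W => C.Nonempty ∧ ∀ b ∈ C, ∃ a ∈ C, G.Adj a b) hex
  have himage : ∀ p : W → W, (∀ b ∈ C, p b ∈ C ∧ G.Adj (p b) b) → C.image p = C := by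
    intro p hp
    have hsub : C.image p ⊆ C := Finset.image_subset_iff.2 fun b hb => (hp b hb).1
    refine hsub.antisymm (hC.2 ⟨hC.1.1.image p, fun b hb => ?_⟩ hsub)
    exact ⟨p b, Finset.mem_image_of_mem p (hsub hb), (hp b (hsub hb)).2⟩
  have hp : ∀ b, ∃ a, b ∈ C → a ∈ C ∧ G.Adj a b := fun b => by
    by_cases hb : b ∈ C
    · obtain ⟨a, ha⟩ := hC.1.2 b hb
      exact ⟨a, fun _ => ha⟩
    · exact ⟨b, fun h => absurd h hb⟩
  choose p hp using hp
  have hinj : Set.InjOn p C := Finset.card_image_iff.1 (by rw [himage p hp])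
  refine ⟨C, p, hC.1.1, ⟨fun b hb => (hp b hb).1, hinj, fun a ha => ?_⟩,
    fun a ha b hb => ⟨fun hab => ?_, fun hab => hab ▸ (hp b hb).2⟩⟩
  · have ha' : a ∈ C.image p := by rwa [himage p hp]
    simpa using ha'
  · by_contra hne
    have hi := himage (Function.update p b a) fun c hc => by
      by_cases hcb : c = b
      · subst hcb
        rw [Function.update_self]
        exact ⟨ha, hab⟩
      · rw [Function.update_of_ne hcb]
        exact hp c hc
    have hm : p b ∈ C.image (Function.update p b a) := by
      rw [hi]
      exact (hp b hb).1
    obtain ⟨c, hc, hcb⟩ := Finset.mem_image.1 hm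
    by_cases h' : c = b
    · subst h'
      rw [Function.update_self] at hcb
      exact hne hcb
    · rw [Function.update_of_ne h'] at hcb
      exact h' (hinj hc hb hcb)

theorem List.IsChain.exists_rel_of_mem {α : Type*} {r : α → α → Prop} {a : α} {l : List α}
    (h : List.IsChain r (a :: l)) {b : α} (hb : b ∈ l) : ∃ c ∈ a :: l, r c b := by
  induction l generalizing a with
  | nil => simp at hb
  | cons d l ih =>
    rw [List.isChain_cons_cons] at h
    rcases List.mem_cons.1 hb with rfl | hb
    · exact ⟨a, List.mem_cons_self, h.1⟩
    · obtain ⟨c, hc, hcb⟩ := ih h.2 hb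
      exact ⟨c, List.mem_cons_of_mem _ hc, hcb⟩

theorem Digraph.not_hasDirectedCycle_iff {W : Type*} [Finite W] (G : Digraph W) :
    ¬ G.HasDirectedCycle ↔ WellFounded G.Adj := by
  classical
  constructor
  · intro h
    by_contra hwf
    obtain ⟨C, p, ⟨x, hx⟩, hp, hadj⟩ := Digraph.exists_bijOn_predecessor hwf
    refine h ?_
    let e : C ≃ C := hp.equiv p
    have he : ∀ b : C, ((e b : C) : W) = p b := fun b => rfl
    have hper : (⟨x, hx⟩ : C) ∈ Function.periodicPts e.symm :=
      e.symm.injective.mem_periodicPts _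
    -- Since `p` picks predecessors, the orbit of its inverse follows the edges forwards.
    refine ⟨(Function.periodicOrbit e.symm ⟨x, hx⟩).map Subtype.val, ?_, ?_, ?_⟩
    · rw [Ne, Cycle.map_eq_nil, Function.periodicOrbit_eq_nil_iff_not_periodic_pt, not_not]
      exact hper
    · have hnd := Function.nodup_periodicOrbit (f := e.symm) (x := ⟨x, hx⟩)
      revert hnd
      induction Function.periodicOrbit e.symm ⟨x, hx⟩ using Quotient.inductionOn with
      | _ l => exact List.Nodup.map Subtype.val_injective
    · rw [Cycle.chain_map, Function.periodicOrbit_chain' _ hper]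
      intro n
      rw [Function.iterate_succ_apply']
      refine (hadj _ (Subtype.mem _) _ (Subtype.mem _)).2 ?_
      rw [← he, Equiv.apply_symm_apply]
  · rintro hwf ⟨c, hc, -, hch⟩
    induction c using Cycle.induction_on with
    | nil => exact hc rfl
    | cons a l _ =>
      rw [Cycle.chain_coe_cons] at hch
      obtain ⟨b, hb, hmin⟩ := hwf.has_min {b | b ∈ a :: l} ⟨a, List.mem_cons_self⟩
      have hb' : b ∈ l ++ [a] := by simpa [or_comm] using hb
      obtain ⟨d, hd, hdb⟩ := hch.exists_rel_of_mem hb'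
      exact hmin d (by simpa [or_comm, or_assoc] using hd) hdb

/-! ### Nonnegative matrices -/

namespace Matrix

theorem subunital_submatrix_fst {α : Type*} [Fintype α] {R : Matrix α α ℕ} {r k : α → ℕ}
    (hk : ∀ b, 1 + ∑ a, R b a * k a ≤ r b * k b) (b : Σ _ : α, Unit) :
    1 + ∑ a : Σ _ : α, Unit, R.submatrix Sigma.fst Sigma.fst b a * k a.1 ≤ r b.1 * k b.1 := by
  rw [Fintype.sum_sigma]
  simpa using hk b.1

variable {n : Type*} [Fintype n] [DecidableEq n]

/-- By induction along the relation, each row of `P ^ m` vanishes for large `m`, because row `b`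
combines the rows of `P ^ (m - 1)` at the predecessors of `b`. -/
theorem isNilpotent_of_wellFounded {K : Type*} [Semiring K] {P : Matrix n n K}
    (h : WellFounded fun a b => P b a ≠ 0) : IsNilpotent P := by
  have key : ∀ b, ∃ m, ∀ m', m ≤ m' → ∀ c, (P ^ m') b c = 0 := by
    intro b
    induction b using h.induction with
    | _ b ih =>
      have : ∀ a, ∃ m, P b a ≠ 0 → ∀ m', m ≤ m' → ∀ c, (P ^ m') a c = 0 := fun a => by
        by_cases ha : P b a = 0
        · exact ⟨0, fun h => absurd ha h⟩
        · obtain ⟨m, hm⟩ := ih a ha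
          exact ⟨m, fun _ => hm⟩
      choose m hm using this
      refine ⟨∑ a, m a + 1, fun m' hm' c => ?_⟩
      obtain ⟨j, rfl⟩ : ∃ j, m' = j + 1 := ⟨m' - 1, by omega⟩
      rw [pow_succ', mul_apply]
      refine Finset.sum_eq_zero fun a _ => ?_
      by_cases ha : P b a = 0
      · rw [ha, zero_mul]
      · have : m a ≤ ∑ a, m a :=
          Finset.single_le_sum (fun _ _ => Nat.zero_le _) (Finset.mem_univ a)
        rw [hm a ha j (by omega), mul_zero]
  choose m hm using key
  refine ⟨∑ b, m b, ?_⟩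
  ext b c
  exact hm b _ (Finset.single_le_sum (fun _ _ => Nat.zero_le _) (Finset.mem_univ b)) c

/-- Over a field the characteristic polynomial of a nilpotent matrix is a power of `X`; its value at
`1` is the determinant. -/
theorem det_one_sub_of_isNilpotent {K : Type*} [Field K] {P : Matrix n n K}
    (h : IsNilpotent P) : (1 - P).det = 1 := by
  have h1 := (isNilpotent_charpoly_sub_pow_of_isNilpotent h).eq_zero
  have h2 := eval_charpoly P 1
  rw [sub_eq_zero.1 h1] at h2
  simpa using h2.symm

variable {K : Type*} [Field K] [LinearOrder K]

/-- A nonnegative matrix that strictly decreases some positive vector. -/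
structure IsSubunital (P : Matrix n n K) (u : n → K) : Prop where
  nonneg : ∀ a b, 0 ≤ P a b
  pos : ∀ a, 0 < u a
  mulVec_lt : ∀ a, (P *ᵥ u) a < u a

namespace IsSubunital

variable {P : Matrix n n K} {u : n → K}

theorem updateRow_zero (h : P.IsSubunital u) (i : n) : (P.updateRow i 0).IsSubunital u where
  nonneg a b := by
    by_cases ha : a = i
    · subst ha; simp
    · rw [updateRow_ne ha]; exact h.nonneg a b
  pos := h.pos
  mulVec_lt a := by
    by_cases ha : a = i
    · subst ha
      simpa [mulVec] using h.pos a
    · simpa [mulVec, updateRow_ne ha] using h.mulVec_lt a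

variable [IsStrictOrderedRing K]

/-- Minimum principle: at a `b` minimizing `x / u` with negative ratio `t`, one has `(P x) b ≥ t (P
u) b > t u b = x b`. -/
theorem nonneg_of_mulVec_nonneg (h : P.IsSubunital u) {x : n → K}
    (hx : ∀ a, 0 ≤ ((1 - P) *ᵥ x) a) (a : n) : 0 ≤ x a := by
  by_contra! ha
  have : Nonempty n := ⟨a⟩
  obtain ⟨b, -, hb⟩ := Finset.exists_min_image Finset.univ (fun c => x c / u c)
    Finset.univ_nonempty
  set t := x b / u b with ht
  have hxb : x b = t * u b := (div_mul_cancel₀ _ (h.pos b).ne').symm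
  have ht0 : t < 0 := (hb a (Finset.mem_univ a)).trans_lt (div_neg_of_neg_of_pos ha (h.pos a))
  have h1 : t * (P *ᵥ u) b ≤ (P *ᵥ x) b := by
    simp only [mulVec, dotProduct, Finset.mul_sum]
    refine Finset.sum_le_sum fun c _ => ?_
    have := (le_div_iff₀ (h.pos c)).1 (hb c (Finset.mem_univ c))
    nlinarith [mul_le_mul_of_nonneg_left this (h.nonneg b c)]
  have h2 := hx b
  rw [sub_mulVec, one_mulVec, Pi.sub_apply] at h2
  nlinarith [mul_lt_mul_of_neg_left (h.mulVec_lt b) ht0]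

theorem det_ne_zero (h : P.IsSubunital u) : (1 - P).det ≠ 0 := by
  intro h0
  obtain ⟨x, hx, hx0⟩ := exists_mulVec_eq_zero_iff.2 h0
  refine hx (funext fun a => le_antisymm ?_ (h.nonneg_of_mulVec_nonneg (by simp [hx0]) a))
  have := h.nonneg_of_mulVec_nonneg (x := -x) (by simp [mulVec_neg, hx0]) a
  simpa using this

theorem inv_nonneg (h : P.IsSubunital u) (a b : n) : 0 ≤ (1 - P)⁻¹ a b := by
  have hu : IsUnit (1 - P).det := h.det_ne_zero.isUnit
  refine h.nonneg_of_mulVec_nonneg (x := fun a => (1 - P)⁻¹ a b) (fun c => ?_) a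
  have : ((1 - P) * (1 - P)⁻¹) c b = (1 : Matrix n n K) c b := by rw [mul_nonsing_inv _ hu]
  rw [mul_apply] at this
  simp only [mulVec, dotProduct, this, one_apply]
  split <;> simp

theorem inv_apply (h : P.IsSubunital u) (a b : n) :
    (1 - P)⁻¹ a b = (if a = b then 1 else 0) + ∑ c, P a c * (1 - P)⁻¹ c b := by
  have hu : IsUnit (1 - P).det := h.det_ne_zero.isUnit
  have : ((1 - P) * (1 - P)⁻¹) a b = (1 : Matrix n n K) a b := by rw [mul_nonsing_inv _ hu]
  rw [sub_mul, one_mul, sub_apply, mul_apply, one_apply] at this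
  linarith

theorem one_le_inv_diag (h : P.IsSubunital u) (a : n) : 1 ≤ (1 - P)⁻¹ a a := by
  rw [h.inv_apply, if_pos rfl]
  exact le_add_of_nonneg_right
    (Finset.sum_nonneg fun c _ => mul_nonneg (h.nonneg a c) (h.inv_nonneg c a))

/-- Zeroing row `i` of `P` turns row `i` of `1 - P` into a unit vector, which leaves a diagonal
cofactor. -/
theorem det_updateRow_zero (h : P.IsSubunital u) (i : n) :
    (1 - P.updateRow i 0).det = (1 - P).det * (1 - P)⁻¹ i i := by
  have h1 : (1 - P).det * (1 - P)⁻¹ i i = (1 - P).adjugate i i := by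
    rw [inv_def, smul_apply, smul_eq_mul, Ring.inverse_eq_inv', mul_inv_cancel_left₀ h.det_ne_zero]
  rw [h1, adjugate_apply]
  congr 1
  ext a b
  by_cases ha : a = i
  · subst ha
    simp [one_apply, Pi.single_apply, eq_comm]
  · simp [updateRow_ne ha]

theorem det_mem_Ioc (h : P.IsSubunital u) : (1 - P).det ∈ Set.Ioc 0 1 := by
  -- Induction on a set containing the nonzero rows: restoring row `i` divides the determinant by a
  -- diagonal entry of the inverse, which is at least `1`.
  suffices ∀ (s : Finset n) (P : Matrix n n K), P.IsSubunital u → (∀ a ∉ s, P a = 0) →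
      (1 - P).det ∈ Set.Ioc 0 1 from this Finset.univ P h fun a ha => absurd (Finset.mem_univ a) ha
  intro s
  induction s using Finset.induction_on with
  | empty =>
    intro P _ hP
    obtain rfl : P = 0 := funext fun a => hP a (Finset.notMem_empty a)
    simp
  | insert i s _ ih =>
    intro P h hP
    obtain ⟨h1, h2⟩ := ih (P.updateRow i 0) (h.updateRow_zero i) fun a ha => by
      by_cases hai : a = i
      · subst hai
        exact funext fun b => by simp
      · rw [← hP a (by simp [hai, ha])]
        exact funext fun b => by rw [updateRow_ne hai]
    rw [h.det_updateRow_zero] at h1 h2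
    have h3 := h.one_le_inv_diag i
    have h4 : 0 < (1 - P).det := pos_of_mul_pos_left h1 (by linarith)
    exact ⟨h4, by nlinarith⟩

theorem inv_pos_of_reflTransGen (h : P.IsSubunital u) {a b : n}
    (hab : Relation.ReflTransGen (fun a b => 0 < P b a) a b) : 0 < (1 - P)⁻¹ b a := by
  induction hab with
  | refl => exact zero_lt_one.trans_le (h.one_le_inv_diag a)
  | @tail c d _ hcd ih =>
    rw [h.inv_apply]
    refine add_pos_of_nonneg_of_pos (by split <;> simp) ?_
    exact (mul_pos hcd ih).trans_le (Finset.single_le_sum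
      (f := fun e => P d e * (1 - P)⁻¹ e a)
      (fun e _ => mul_nonneg (h.nonneg d e) (h.inv_nonneg e a)) (Finset.mem_univ c))

/-- With determinant `1`, `(1 - P)⁻¹ i i` is the determinant after zeroing row `i`, hence at most
`1`. A closed walk through `i` would add a positive term to the `1` already there. -/
theorem wellFounded_of_det_eq_one (h : P.IsSubunital u) (hdet : (1 - P).det = 1) :
    WellFounded fun a b => 0 < P b a := by
  have hdiag : ∀ i, (1 - P)⁻¹ i i ≤ 1 := fun i => by
    have := (h.updateRow_zero i).det_mem_Ioc.2
    rwa [h.det_updateRow_zero, hdet, one_mul] at this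
  have hirr : Std.Irrefl (Relation.TransGen fun a b => 0 < P b a) := ⟨fun i hi => by
    obtain ⟨a, hia, hai⟩ := Relation.TransGen.tail'_iff.1 hi
    have h1 := h.inv_pos_of_reflTransGen hia
    have h2 := (mul_pos hai h1).trans_le (Finset.single_le_sum
      (f := fun e => P i e * (1 - P)⁻¹ e i)
      (fun e _ => mul_nonneg (h.nonneg i e) (h.inv_nonneg e i)) (Finset.mem_univ a))
    have h3 := hdiag i
    rw [h.inv_apply, if_pos rfl] at h3
    linarith⟩
  exact Subrelation.wf (r := Relation.TransGen fun a b => 0 < P b a)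
    (fun {_ _} h => Relation.TransGen.single h) (Finite.wellFounded_of_trans_of_irrefl _)

end IsSubunital

end Matrix

/-! ### Recurrent states of a processor -/

namespace AbelianProcessor

variable {I Q U : Type*} {B : U → Type*}

theorem run_perm (p : AbelianProcessor I Q B) {w w' : List I} (h : w.Perm w') (q : Q) :
    p.run w q = p.run w' q := by
  induction h generalizing q with
  | nil => rfl
  | cons a _ ih => exact ih _
  | swap a b w => simp only [Processor.run, p.t_comm a b]
  | trans _ _ ih ih' => rw [ih, ih']

theorem run_mem_transitionMonoid (p : AbelianProcessor I Q B) (w : List I) :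
    (p.run w : Function.End Q) ∈ p.transitionMonoid := by
  induction w with
  | nil => exact p.transitionMonoid.one_mem
  | cons a w ih =>
    exact p.transitionMonoid.mul_mem ih (Submonoid.subset_closure ⟨a, rfl⟩)

theorem exists_run_of_mem (p : AbelianProcessor I Q B) {m : Function.End Q}
    (hm : m ∈ p.transitionMonoid) : ∃ w, m = p.run w := by
  induction hm using Submonoid.closure_induction with
  | mem f hf => obtain ⟨a, rfl⟩ := hf; exact ⟨[a], rfl⟩
  | one => exact ⟨[], rfl⟩
  | mul f g _ _ hf hg =>
    obtain ⟨w, rfl⟩ := hf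
    obtain ⟨w', rfl⟩ := hg
    exact ⟨w' ++ w, funext fun q => (p.run_append w' w q).symm⟩

theorem run_eq_self_of_mem_kernel [DecidableEq I] (p : AbelianProcessor I Q B) {z : List I}
    (hz : (fun a => (z.count a : ℤ)) ∈ p.kernel) {q : Q}
    (hq : q ∈ recurrentSet p.transitionMonoid) : p.run z q = q := by
  obtain ⟨w, w', hc, hw⟩ := hz
  obtain ⟨e, he, y, rfl⟩ := hq
  have hp : w.Perm (w' ++ z) := List.perm_iff_count.2 fun a => by
    have := hc a
    dsimp only at this
    rw [List.count_append]
    omega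
  have h1 := hw (e y) ⟨e, he, y, rfl⟩
  rw [p.run_perm hp, run_append] at h1
  -- Minimality of the idempotent lets `m` undo `w'` on the recurrent set, so `w'` cancels.
  obtain ⟨m, hm, hme⟩ := he.2.2 _ (p.run_mem_transitionMonoid w')
  have h2 : m (p.run w' (e y)) = e y := (congrFun hme (e y)).trans (congrFun he.2.1 y)
  rw [← h2, p.comm_run hm, h1]

end AbelianProcessor

namespace AbelianNetwork

section LocallyRecurrent

variable {V : Type*} {A Q : V → Type*} [DecidableEq V]

theorem finalState_map (N : AbelianNetwork V A Q) {v : V} (w : List (A v)) (q : ∀ v, Q v) :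
    N.finalState (w.map (Sigma.mk v)) q = Function.update q v ((N.proc v).run w (q v)) := by
  induction w generalizing q with
  | nil => simp [finalState, Processor.run]
  | cons a w ih => simp [finalState, Processor.run, ih, move]

variable [∀ v, DecidableEq (A v)]

theorem sent_map (N : AbelianNetwork V A Q) {v : V} (w : List (A v)) (q : ∀ v, Q v)
    (b : Σ v, A v) :
    N.sent (w.map (Sigma.mk v)) q b = ((N.proc v).output b.1 w (q v)).count b.2 := by
  induction w generalizing q with
  | nil => simp [sent, Processor.output]
  | cons a w ih => simp [sent, Processor.output, ih, move]

theorem resetNumber_ne_zero [∀ v, Finite (Q v)] (N : AbelianNetwork V A Q) (a : Σ v, A v) :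
    N.resetNumber a ≠ 0 :=
  Nat.one_le_iff_ne_zero.1 (N.one_le_resetNumber a)

theorem IsLocallyRecurrent.finalState_replicate [∀ v, Finite (Q v)] {N : AbelianNetwork V A Q}
    {q : ∀ v, Q v} (hq : N.IsLocallyRecurrent q) (a : Σ v, A v) :
    N.finalState (List.replicate (N.resetNumber a) a) q = q := by
  have hr := N.one_le_resetNumber a
  have hmem := (Nat.sInf_mem (Nat.nonempty_of_pos_sInf hr)).2
  obtain ⟨v, a⟩ := a
  have h1 := hmem v
  rw [← List.map_replicate, finalState_map, AbelianProcessor.run_eq_self_of_mem_kernel _ _ (hq v),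
    Function.update_eq_self]
  convert h1 using 1
  funext b
  by_cases hab : a = b
  · subst hab
    simp [resetNumber]
  · rw [Pi.single_eq_of_ne (by simpa using Ne.symm hab)]
    simp [List.count_replicate, hab]

/-- The production does not depend on the locally recurrent state. -/
theorem IsLocallyRecurrent.sent_replicate [∀ v, Finite (Q v)] {N : AbelianNetwork V A Q}
    (hN : N.IsIrreducible) {q q' : ∀ v, Q v} (hq : N.IsLocallyRecurrent q)
    (hq' : N.IsLocallyRecurrent q') (a b : Σ v, A v) :
    N.sent (List.replicate (N.resetNumber a) a) q b =
      N.sent (List.replicate (N.resetNumber a) a) q' b := by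
  -- A full period of `a` returns to `q`, so moving it past `w` does not change what `w` sends. The
  -- period therefore sends the same from `q` as after `w`; irreducibility then joins the two local
  -- states.
  have key : ∀ q, N.IsLocallyRecurrent q → ∀ w : List (A a.1),
      N.sent (List.replicate (N.resetNumber a) a) q b =
        ((N.proc a.1).output b.1 (List.replicate (N.resetNumber a) a.2)
          ((N.proc a.1).run w (q a.1))).count b.2 := by
    intro q hq w
    have h1 := N.sent_perm (List.perm_append_comm (l₁ := List.replicate (N.resetNumber a) a)
      (l₂ := w.map (Sigma.mk a.1))) q b
    rw [sent_append, sent_append, hq.finalState_replicate, finalState_map] at h1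
    have h2 := N.sent_map (List.replicate (N.resetNumber a) a.2)
      (Function.update q a.1 ((N.proc a.1).run w (q a.1))) b
    rw [List.map_replicate, Function.update_self] at h2
    rw [← h2]
    change _ = N.sent (List.replicate (N.resetNumber a) a) _ b
    omega
  obtain ⟨m, hm, m', hm', h⟩ := (hN a.1).2 (q a.1) (q' a.1)
  obtain ⟨w, rfl⟩ := (N.proc a.1).exists_run_of_mem hm
  obtain ⟨w', rfl⟩ := (N.proc a.1).exists_run_of_mem hm'
  rw [key q hq w, key q' hq' w', h]

/-- The integer matrix `P D`, whose column `a` is `P(r_a 1_a)`. -/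
noncomputable def productionCount (N : AbelianNetwork V A Q) (q : ∀ v, Q v) :
    Matrix (Σ v, A v) (Σ v, A v) ℕ :=
  Matrix.of fun b a => N.sent (List.replicate (N.resetNumber a) a) q b

theorem productionMatrix_apply (N : AbelianNetwork V A Q) (q : ∀ v, Q v) (a b : Σ v, A v) :
    N.productionMatrix q b a = (N.productionCount q b a : ℚ) / N.resetNumber a := by
  simp [productionMatrix, productionCount, localAct, exec_eq]

theorem productionMatrix_pos_iff [∀ v, Finite (Q v)] (N : AbelianNetwork V A Q) (q : ∀ v, Q v)
    (a b : Σ v, A v) : 0 < N.productionMatrix q b a ↔ 0 < N.productionCount q b a := by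
  have hr : (0 : ℚ) < N.resetNumber a := Nat.cast_pos.2 (N.one_le_resetNumber a)
  rw [productionMatrix_apply, div_pos_iff_of_pos_right hr, Nat.cast_pos]

theorem isPeriodicOn_isLocallyRecurrent [∀ v, Finite (Q v)] {N : AbelianNetwork V A Q}
    (hN : N.IsIrreducible) {q₀ : ∀ v, Q v} (hq₀ : N.IsLocallyRecurrent q₀) :
    N.IsPeriodicOn {q | N.IsLocallyRecurrent q} N.resetNumber (N.productionCount q₀) where
  one_le := N.one_le_resetNumber
  move_mem := fun q hq a v => by
    by_cases hv : v = a.1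
    · subst hv
      rw [move, Function.update_self]
      exact (N.proc a.1).run_mem_recurrentSet [a.2] (hq a.1)
    · rw [move, Function.update_of_ne hv]
      exact hq v
  finalState_replicate := fun _ hq => IsLocallyRecurrent.finalState_replicate hq
  sent_replicate := fun _ hq => IsLocallyRecurrent.sent_replicate hN hq hq₀

end LocallyRecurrent

/-! ### States from which a cycle feeds itself -/

variable {V : Type*} {A Q : V → Type*} [DecidableEq V] [∀ v, DecidableEq (A v)]

theorem exists_move_sent_pos (N : AbelianNetwork V A Q) {a b : Σ v, A v} {m : ℕ} {q : ∀ v, Q v}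
    (h : 0 < N.sent (List.replicate m a) q b) :
    ∃ j, 1 ≤ N.sent [a] (N.finalState (List.replicate j a) q) b := by
  induction m generalizing q with
  | zero => simp [sent] at h
  | succ m ih =>
    by_cases h0 : N.sent [a] q b = 0
    · rw [List.replicate_succ, ← List.singleton_append, sent_append, h0, zero_add] at h
      obtain ⟨j, hj⟩ := ih h
      exact ⟨j + 1, hj⟩
    · exact ⟨0, Nat.one_le_iff_ne_zero.2 h0⟩

/-- The letter `p b` can be advanced until its next processing sends `b`. It never sends another `c`
in `C`, so commuting it past `p c` preserves what was arranged for `c`. -/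
theorem IsPeriodicOn.exists_forall_sent {N : AbelianNetwork V A Q} {S : Set (∀ v, Q v)}
    {r : (Σ v, A v) → ℕ} {R : Matrix (Σ v, A v) (Σ v, A v) ℕ} (h : N.IsPeriodicOn S r R)
    {q₀ : ∀ v, Q v} (hq₀ : q₀ ∈ S) {C : Finset (Σ v, A v)} {p : (Σ v, A v) → Σ v, A v}
    (hp : Set.BijOn p C C) (hR : ∀ a ∈ C, ∀ b ∈ C, 0 < R b a ↔ a = p b) :
    ∃ q ∈ S, ∀ b ∈ C, 1 ≤ N.sent [p b] q b := by
  suffices ∀ D ⊆ C, ∃ q ∈ S, ∀ b ∈ D, 1 ≤ N.sent [p b] q b from this C subset_rfl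
  intro D
  induction D using Finset.induction_on with
  | empty => exact fun _ => ⟨q₀, hq₀, by simp⟩
  | insert b D hb ih =>
    intro hD
    rw [Finset.insert_subset_iff] at hD
    obtain ⟨q, hq, hqD⟩ := ih hD.2
    have hpb : 0 < N.sent (List.replicate (r (p b)) (p b)) q b := by
      rw [h.sent_replicate q hq]
      exact (hR _ (hp.mapsTo hD.1) b hD.1).2 rfl
    obtain ⟨j, hj⟩ := N.exists_move_sent_pos hpb
    refine ⟨_, h.finalState_mem hq (List.replicate j (p b)), fun c hc => ?_⟩
    rcases Finset.mem_insert.1 hc with rfl | hcD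
    · exact hj
    · have hcC := hD.2 hcD
      have hne : p b ≠ p c := fun heq => hb (hp.injOn hD.1 hcC heq ▸ hcD)
      have hzero : ∀ q ∈ S, N.sent (List.replicate j (p b)) q c = 0 := fun q hq => by
        refine h.sent_eq_zero hq fun a ha => ?_
        obtain rfl := List.eq_of_mem_replicate ha
        exact Nat.eq_zero_of_not_pos fun h0 => hne ((hR _ (hp.mapsTo hD.1) c hcC).1 h0)
      have h1 := N.sent_perm (List.perm_append_comm (l₁ := List.replicate j (p b))
        (l₂ := [p c])) q c
      rw [sent_append, sent_append, hzero q hq, hzero _ (h.finalState_mem hq _)] at h1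
      have := hqD c hcD
      omega

theorem IsPeriodicOn.wellFounded [Fintype V] [∀ v, Fintype (A v)]
    {N : AbelianNetwork V A Q} {S : Set (∀ v, Q v)}
    {r : (Σ v, A v) → ℕ} {R : Matrix (Σ v, A v) (Σ v, A v) ℕ} (h : N.IsPeriodicOn S r R)
    (hN : N.HaltsOnAllInputs) {q₀ : ∀ v, Q v} (hq₀ : q₀ ∈ S)
    (hrec : ∀ q ∈ S, N.IsRecurrent q) : WellFounded fun a b => 0 < R b a := by
  by_contra hwf
  obtain ⟨C, p, hC, hp, hadj⟩ :=
    Digraph.exists_bijOn_predecessor (G := { Adj := fun a b => 0 < R b a }) hwf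
  obtain ⟨k, hk⟩ := h.exists_subunital hq₀ hN
  obtain ⟨q, hq, hqC⟩ := h.exists_forall_sent hq₀ hp hadj
  refine h.not_isRecurrent hN hk hq (w := C.toList) (by simpa using hC.ne_empty) C.nodup_toList
    (fun b hb => ?_) (hrec _ (h.finalState_mem hq _))
  have hbC := Finset.mem_toList.1 hb
  refine (hqC b hbC).trans (N.sent_mono (fun a => ?_) q b)
  rw [List.count_singleton]
  split_ifs with hab
  · rw [beq_iff_eq] at hab
    exact List.count_pos_iff.2 (Finset.mem_toList.2 (hab ▸ hp.mapsTo hbC))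
  · exact Nat.zero_le _

/-! ### The sandpilization -/

theorem _root_.ZMod.sum_range_ite_add_eq_zero {n : ℕ} (hn : 1 ≤ n) (x : ZMod n) (c : ℕ) :
    ∑ j ∈ Finset.range n, (if x + j + 1 = 0 then c else 0) = c := by
  have : NeZero n := ⟨by omega⟩
  rw [Finset.sum_eq_single (-(x + 1)).val]
  · rw [ZMod.natCast_zmod_val, if_pos (by ring)]
  · intro j hj hne
    refine if_neg fun h => hne ?_
    have : (j : ZMod n) = -(x + 1) := by linear_combination h
    rw [← this, ZMod.val_cast_of_lt (Finset.mem_range.1 hj)]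
  · intro h
    exact absurd (Finset.mem_range.2 (ZMod.val_lt _)) h

theorem sandpilization_move (N : AbelianNetwork V A Q) (q : ∀ v, Q v) (a : Σ v, A v)
    (s : ∀ a, ZMod (N.resetNumber a)) :
    (N.sandpilization q).move ⟨a, ()⟩ s = Function.update s a (s a + 1) := rfl

theorem sandpilization_finalState (N : AbelianNetwork V A Q) (q : ∀ v, Q v)
    (w : List (Σ _ : (Σ v, A v), Unit)) (s : ∀ a, ZMod (N.resetNumber a)) (a : Σ v, A v) :
    (N.sandpilization q).finalState w s a = s a + w.count ⟨a, ()⟩ := by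
  induction w generalizing s with
  | nil => simp [finalState]
  | cons b w ih =>
    obtain ⟨b, ⟨⟩⟩ := b
    rw [finalState, ih, sandpilization_move, List.count_cons]
    by_cases hab : a = b
    · subst hab
      simp
      ring
    · rw [Function.update_of_ne hab]
      simp [Ne.symm hab]

theorem sandpilization_sent_singleton [∀ v, Finite (Q v)] (N : AbelianNetwork V A Q)
    (q : ∀ v, Q v) (a b : Σ v, A v) (s : ∀ a, ZMod (N.resetNumber a)) :
    (N.sandpilization q).sent [⟨a, ()⟩] s ⟨b, ()⟩ =
      if s a + 1 = 0 then N.productionCount q b a else 0 := by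
  have hr : (N.resetNumber a : ℚ) ≠ 0 := Nat.cast_ne_zero.2 (N.resetNumber_ne_zero a)
  have h : ⌊(N.resetNumber a : ℚ) * N.productionMatrix q b a⌋₊ = N.productionCount q b a := by
    rw [productionMatrix_apply, mul_div_cancel₀ _ hr, Nat.floor_natCast]
  simp only [sent, sandpilization, sandpileProcessor, h]
  split_ifs <;> simp

theorem sandpilization_sent_replicate [∀ v, Finite (Q v)] (N : AbelianNetwork V A Q)
    (q : ∀ v, Q v) (a b : Σ v, A v) (m : ℕ) (s : ∀ a, ZMod (N.resetNumber a)) :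
    (N.sandpilization q).sent (List.replicate m ⟨a, ()⟩) s ⟨b, ()⟩ =
      ∑ j ∈ Finset.range m, if s a + j + 1 = 0 then N.productionCount q b a else 0 := by
  induction m with
  | zero => simp [sent]
  | succ m ih =>
    rw [List.replicate_succ', sent_append, ih, Finset.sum_range_succ,
      sandpilization_sent_singleton, sandpilization_finalState, List.count_replicate_self]

theorem isPeriodicOn_sandpilization [∀ v, Finite (Q v)] (N : AbelianNetwork V A Q)
    (q : ∀ v, Q v) : (N.sandpilization q).IsPeriodicOn Set.univ (fun a => N.resetNumber a.1)
      ((N.productionCount q).submatrix Sigma.fst Sigma.fst) where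
  one_le := fun a => N.one_le_resetNumber a.1
  move_mem := fun _ _ _ => Set.mem_univ _
  finalState_replicate := fun s _ a => by
    obtain ⟨a, ⟨⟩⟩ := a
    funext c
    rw [sandpilization_finalState, List.count_replicate]
    by_cases hac : a = c
    · subst hac
      simp
    · simp [hac]
  sent_replicate := fun s _ a b => by
    obtain ⟨a, ⟨⟩⟩ := a
    obtain ⟨b, ⟨⟩⟩ := b
    rw [sandpilization_sent_replicate]
    exact ZMod.sum_range_ite_add_eq_zero (N.one_le_resetNumber a) _ _

theorem wellFounded_of_isRecurrent_sandpilization_zero [Fintype V] [∀ v, Fintype (A v)]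
    [∀ v, Finite (Q v)] {N : AbelianNetwork V A Q} {q₀ : ∀ v, Q v} {k : (Σ v, A v) → ℕ}
    (hk : ∀ b, 1 + ∑ a, N.productionCount q₀ b a * k a ≤ N.resetNumber b * k b)
    (h : (N.sandpilization q₀).IsRecurrent 0) :
    WellFounded fun a b => 0 < N.productionCount q₀ b a := by
  by_contra hwf
  obtain ⟨C, p, hC, hp, hadj⟩ := Digraph.exists_bijOn_predecessor
    (G := { Adj := fun a b => 0 < N.productionCount q₀ b a }) hwf
  have hper := N.isPeriodicOn_sandpilization q₀
  have hk' := Matrix.subunital_submatrix_fst hk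
  -- Every counter in `C` is one step before wrapping: one letter at each of them makes all fire and
  -- reaches `0`.
  let s : ∀ a, ZMod (N.resetNumber a) := fun a => if a ∈ C then -1 else 0
  let w : List (Σ _ : (Σ v, A v), Unit) := C.toList.map fun a => ⟨a, ()⟩
  have hinj : Function.Injective fun a : Σ v, A v => (⟨a, ()⟩ : Σ _ : (Σ v, A v), Unit) :=
    fun a b hab => congrArg Sigma.fst hab
  have hnd : w.Nodup := C.nodup_toList.map hinj
  have hmem : ∀ a, (⟨a, ()⟩ : Σ _ : (Σ v, A v), Unit) ∈ w ↔ a ∈ C := fun a => by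
    simp [w]
  have hs : (N.sandpilization q₀).finalState w s = 0 := by
    funext a
    rw [sandpilization_finalState, hnd.count]
    by_cases ha : a ∈ C <;> simp [hmem, s, ha]
  refine hper.not_isRecurrent (hper.haltsOnAllInputs hk') hk' (Set.mem_univ s) (w := w)
    (by simpa [w] using hC.ne_empty) hnd (fun b hb => ?_) (hs ▸ h)
  obtain ⟨b, ⟨⟩⟩ := b
  have hbC := (hmem b).1 hb
  have hpC := hp.mapsTo hbC
  have h1 : 1 ≤ (N.sandpilization q₀).sent [⟨p b, ()⟩] s ⟨b, ()⟩ := by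
    rw [sandpilization_sent_singleton, if_pos]
    · exact (hadj _ hpC b hbC).2 rfl
    · have : p b ∈ C := hpC
      simp [s, this]
  refine h1.trans ((N.sandpilization q₀).sent_mono (fun a => ?_) s ⟨b, ()⟩)
  rw [List.count_singleton]
  split_ifs with hab
  · rw [beq_iff_eq] at hab
    exact List.count_pos_iff.2 (hab ▸ (hmem _).2 hpC)
  · exact Nat.zero_le _

theorem isSubunital_productionMatrix [Fintype V] [∀ v, Fintype (A v)] [∀ v, Finite (Q v)]
    {N : AbelianNetwork V A Q} {q₀ : ∀ v, Q v} {k : (Σ v, A v) → ℕ}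
    (hk : ∀ b, 1 + ∑ a, N.productionCount q₀ b a * k a ≤ N.resetNumber b * k b) :
    (N.productionMatrix q₀).IsSubunital fun a => (N.resetNumber a * k a : ℚ) where
  nonneg a b := by
    rw [productionMatrix_apply]
    positivity
  pos a := by
    have h : 0 < N.resetNumber a * k a := lt_of_lt_of_le (by omega) (hk a)
    exact_mod_cast h
  mulVec_lt b := by
    have h : ∑ a, N.productionCount q₀ b a * k a < N.resetNumber b * k b :=
      lt_of_lt_of_le (by omega) (hk b)
    have h' : (N.productionMatrix q₀).mulVec (fun a => (N.resetNumber a * k a : ℚ)) b =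
        ((∑ a, N.productionCount q₀ b a * k a : ℕ) : ℚ) := by
      simp only [Matrix.mulVec, dotProduct, productionMatrix_apply]
      push_cast
      refine Finset.sum_congr rfl fun a _ => ?_
      have hr : (N.resetNumber a : ℚ) ≠ 0 := Nat.cast_ne_zero.2 (N.resetNumber_ne_zero a)
      field_simp
    rw [h']
    exact_mod_cast h

theorem det_laplacian_eq_iff [Fintype V] [∀ v, Fintype (A v)] [∀ v, Finite (Q v)]
    (N : AbelianNetwork V A Q) (q : ∀ v, Q v) :
    (N.laplacian q).det = N.resetMatrix.det ↔ (1 - N.productionMatrix q).det = 1 := by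
  have h : N.resetMatrix.det ≠ 0 := by
    rw [resetMatrix, Matrix.det_diagonal]
    exact Finset.prod_ne_zero_iff.2 fun a _ => Nat.cast_ne_zero.2 (N.resetNumber_ne_zero a)
  rw [laplacian, Matrix.det_mul, mul_eq_right₀ h]

end AbelianNetwork

theorem theorem3p21 {V : Type*} {A Q : V → Type*}
    [DecidableEq V] [∀ v, DecidableEq (A v)]
    [Fintype V] [∀ v, Fintype (A v)] [∀ v, Finite (Q v)]
    (N : AbelianNetwork V A Q) (hirr : N.IsIrreducible) (hhalt : N.HaltsOnAllInputs)
    (q₀ : ∀ v, Q v) (hq₀ : N.IsLocallyRecurrent q₀) :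
    List.TFAE [
      ∀ q, N.IsLocallyRecurrent q → N.IsRecurrent q,
      (N.laplacian q₀).det = N.resetMatrix.det,
      ∀ s, (N.sandpilization q₀).IsRecurrent s,
      (N.sandpilization q₀).IsRecurrent 0,
      ¬ (N.productionGraph q₀).HasDirectedCycle,
      IsNilpotent (N.productionMatrix q₀)] := by
  have hper := AbelianNetwork.isPeriodicOn_isLocallyRecurrent hirr hq₀
  have hsand := N.isPeriodicOn_sandpilization q₀
  obtain ⟨k, hk⟩ := hper.exists_subunital hq₀ hhalt
  have hP := AbelianNetwork.isSubunital_productionMatrix hk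
  have hk' := Matrix.subunital_submatrix_fst hk
  have hfin : ∀ a, Finite (ZMod (N.resetNumber a)) := fun a => by
    have : NeZero (N.resetNumber a) := ⟨N.resetNumber_ne_zero a⟩
    infer_instance
  have hadj : (N.productionGraph q₀).Adj = fun a b => 0 < N.productionCount q₀ b a :=
    funext₂ fun a b => propext (N.productionMatrix_pos_iff q₀ a b)
  rw [N.det_laplacian_eq_iff, Digraph.not_hasDirectedCycle_iff]
  tfae_have 1 → 5 := fun h => hadj ▸ hper.wellFounded hhalt hq₀ h
  tfae_have 5 → 1 := fun h q hq => hper.isRecurrent hhalt hk (hadj ▸ h) hq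
  tfae_have 5 → 3 := fun h s =>
    hsand.isRecurrent (hsand.haltsOnAllInputs hk') hk'
      (InvImage.wf Sigma.fst (hadj ▸ h)) (Set.mem_univ s)
  tfae_have 3 → 4 := fun h => h 0
  tfae_have 4 → 5 := fun h =>
    hadj ▸ AbelianNetwork.wellFounded_of_isRecurrent_sandpilization_zero hk h
  tfae_have 5 → 6 := fun h => Matrix.isNilpotent_of_wellFounded
    (Subrelation.wf (fun {a b} hab => lt_of_le_of_ne (hP.nonneg b a) (Ne.symm hab)) h)
  tfae_have 6 → 2 := Matrix.det_one_sub_of_isNilpotent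
  tfae_have 2 → 5 := hP.wellFounded_of_det_eq_one
  tfae_finish
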